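/- **Diagrams.** A diagram is a finite graph with trivalent and univalent vertices (closed components without vertices are allowed), each trivalent vertex carrying a cyclic orientation of its three half-edges. The univalent vertices and the edges ending in them are called legs. **The polynomial $CD$.** For $N\ge 0$ let $e_{ij}$ be the standard generators of $\mathfrak{gl}(N)=\mathfrak{gl}(N,\mathbb C)$, with the metric $t(x,y)=\operatorname{tr}(xy)$. For a diagram $\Gamma$ with $u$ legs let $W_{\mathfrak{gl}(N)}(\Gamma)\in U(\mathfrak{gl}(N))$ be the usual Lie algebra weight system: place the tensor $t([x,y],z)$ at each trivalent vertex (arguments in the cyclic order), contract along the edges with $\sum_{i,j} e_{ij}\otimes e_{ji}$, multiply the elements of $\mathfrak{gl}(N)$ at the univalent vertices in some order, and average over all $u!$ orders; a closed component without vertices contributes $\dim \mathfrak{gl}(N)=N^2$. Let $c_0=N$ and $$c_j=\sum_{i_1,\dots,i_j=1}^{N} e_{i_1i_2}e_{i_2i_3}\cdots e_{i_ji_1}\in Z(U(\mathfrak{gl}(N)))\qquad (j\ge 1)$$ be the generalized Casimir elements. The part of highest weight $\overline W(\Gamma)\in\mathbb C[c_0,c_1,c_2,\dots]$ is the polynomial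 all of whose monomials have weight $u$ (where $c_j$ has weight $j$) such that for every $N\ge u$ the elements $W_{\mathfrak{gl}(N)}(\Gamma)$ and $\overline W(\Gamma)|_{c_0=N}$ of $U(\mathfrak{gl}(N))$ differ by a linear combination of words of length less than $u$ in elements of $\mathfrak{gl}(N)$. The polynomial $CD(\Gamma)$ is the homogeneous part of highest degree of $\overline W(\Gamma)$, where now every $c_j$ has degree one. **Pont Neuf diagrams.** Let $k\ge 1$ and $a_1,\dots,a_k,b\ge 0$. Take a plane cycle with $k+1$ vertices $r_1,\dots,r_{k-1},q,p$ in counterclockwise order, and inside it a path $p,t_1,\dots,t_{k-1},q$ together with edges $t_ir_i$ ($1\le i\le k-1$); this is a plane cubic graph with $2k$ vertices. Attach legs pointing into the outer face: $a_i$ legs to the $i$-th of the $k$ consecutive edges of the path $p,r_1,\dots,r_{k-1},q$ on the cycle, and $2b$ legs to the remaining edge $qp$ of the cycle. All trivalent vertices are oriented counterclockwise. The result is $\Gamma(a_1,\dots,a_k,b)$; it has $a_1+\dots+a_k+2b$ legs. For $k=0$, $\Gamma(b)$ is a circle with $2b$ legs pointing outwards. **Theorem.** Let $k\ge 0$ and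 let $u\ge 0$ be even. Let $\mathcal S_{k,u}$ be the set of all tuples $(a_1,\dots,a_k,b)$ of integers with $0\le a_1\le\dots\le a_k\le b$ and $a_1+\dots+a_k+2b=u$. Then for every $(a_1,\dots,a_k,b)\in\mathcal S_{k,u}$ the polynomial $\overline W(\Gamma(a_1,\dots,a_k,b))$ exists and is unique, and the polynomials $CD(\Gamma(a_1,\dots,a_k,b))$, $(a_1,\dots,a_k,b)\in\mathcal S_{k,u}$, are linearly independent over $\mathbb C$. -/

import Mathlib

/-! ## Diagrams with trivalent and univalent vertices -/

/-- A finite graph all of whose vertices are trivalent or univalent, each trivalent vertex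
carrying a cyclic orientation. `V` is the type of trivalent vertices, `L` the type of univalent
vertices, `E` the type of edges. The half-edges are `(v, 0), (v, 1), (v, 2)` at the trivalent
vertex `v`, listed in its (counterclockwise) cyclic order, and one half-edge at each univalent
vertex. An edge `e` consists of the two half-edges `src e` and `tgt e` (the direction is
irrelevant), and every half-edge belongs to exactly one edge. `circles` is the number of closed
components without vertices. -/
structure Diagram where
  V : Type
  L : Type
  E : Type
  [fintypeV : Fintype V]
  [fintypeL : Fintype L]
  [fintypeE : Fintype E]
  [decEqV : DecidableEq V]
  [decEqL : DecidableEq L]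
  [decEqE : DecidableEq E]
  src : E → (V × Fin 3) ⊕ L
  tgt : E → (V × Fin 3) ⊕ L
  bijective_ends : Function.Bijective (Sum.elim src tgt)
  circles : ℕ

namespace Diagram

attribute [instance] Diagram.fintypeV Diagram.fintypeL Diagram.fintypeE
  Diagram.decEqV Diagram.decEqL Diagram.decEqE

/-- The half-edges of a diagram. -/
abbrev HalfEdge (Γ : Diagram) : Type := (Γ.V × Fin 3) ⊕ Γ.L

/-- The number of univalent vertices. -/
def legs (Γ : Diagram) : ℕ := Fintype.card Γ.L

end Diagram

/-! ## The weight system of the Lie algebra `gl(N)` -/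

attribute [local instance 100] LieRing.ofAssociativeRing

/-- The Lie algebra `gl(N)` over `ℂ`. -/
abbrev glN (N : ℕ) : Type := Matrix (Fin N) (Fin N) ℂ

/-- The universal enveloping algebra `U(gl(N))`. -/
abbrev UgN (N : ℕ) : Type := UniversalEnvelopingAlgebra ℂ (glN N)

/-- The standard generator `e_{ij}` of `gl(N)`, indexed by the pair `(i, j)`. -/
noncomputable def egl (N : ℕ) (p : Fin N × Fin N) : glN N := Matrix.single p.1 p.2 1

/-- The image of `e_{ij}` in `U(gl(N))`. -/
noncomputable def eUgl (N : ℕ) (p : Fin N × Fin N) : UgN N :=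
  UniversalEnvelopingAlgebra.ι ℂ (egl N p)

/-- The invariant tensor `t([x, y], z)` attached to a trivalent vertex, for the metric
`t(x, y) = tr (x y)`. -/
noncomputable def structureTensor {N : ℕ} (x y z : glN N) : ℂ := (⁅x, y⁆ * z).trace

/-- Labelings of the half-edges by the basis `e_{ij}` of `gl(N)` such that the two halves of each
edge carry dual basis elements; the dual basis of `e_{ij}` with respect to `tr (x y)` is `e_{ji}`.
(Summing over these labelings inserts the Casimir element `∑ e_{ij} ⊗ e_{ji}` on each edge.) -/
def Diagram.IsLabeling (Γ : Diagram) (N : ℕ) (ℓ : Γ.HalfEdge → Fin N × Fin N) : Prop :=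
  ∀ e, ℓ (Γ.tgt e) = (ℓ (Γ.src e)).swap

open Classical in
/-- The weight system of `(gl(N), tr (x y))` on a diagram, with values in `U(gl(N))`.
The univalent vertices are placed on an oriented circle in all possible orders and the average is
taken (this is the isomorphism between unitrivalent diagrams and chord diagrams); for each order
`o`, the invariant tensors at the trivalent vertices are contracted along the edges, and the
basis elements at the univalent vertices are multiplied in the order `o`. A closed component
without vertices contributes `dim gl(N) = N ^ 2`. -/
noncomputable def Diagram.glWeight (Γ : Diagram) (N : ℕ) : UgN N :=
  ((N : ℂ) ^ 2) ^ Γ.circles • ((Γ.legs.factorial : ℂ)⁻¹ •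
    ∑ o : Fin Γ.legs ≃ Γ.L,
      ∑ ℓ : Γ.HalfEdge → Fin N × Fin N with Γ.IsLabeling N ℓ,
        (∏ v : Γ.V, structureTensor (egl N (ℓ (Sum.inl (v, 0)))) (egl N (ℓ (Sum.inl (v, 1))))
            (egl N (ℓ (Sum.inl (v, 2))))) •
          (List.ofFn fun t : Fin Γ.legs => eUgl N (ℓ (Sum.inr (o t)))).prod)

/-! ## Generalized Casimir elements -/

/-- The matrix over `U(gl(N))` whose `(i, j)` entry is `e_{ij}`. -/
noncomputable def genericMatrix (N : ℕ) : Matrix (Fin N) (Fin N) (UgN N) :=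
  Matrix.of fun i j => eUgl N (i, j)

/-- The generalized Casimir element
`c_j = ∑ e_{i₁ i₂} e_{i₂ i₃} ⋯ e_{i_j i₁}`, i.e. the trace of the `j`-th power of the matrix
`(e_{ij})`; for `j = 0` this is `c_0 = N`. -/
noncomputable def casimirElt (N j : ℕ) : UgN N := (genericMatrix N ^ j).trace

theorem casimirElt_zero (N : ℕ) : casimirElt N 0 = (N : UgN N) := by
  simp [casimirElt]

theorem eUgl_mul_sub (N : ℕ) (a b c d : Fin N) :
    eUgl N (a, b) * eUgl N (c, d) - eUgl N (c, d) * eUgl N (a, b) =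
      (if b = c then eUgl N (a, d) else 0) - (if a = d then eUgl N (c, b) else 0) := by
  have h := (UniversalEnvelopingAlgebra.ι ℂ).map_lie (egl N (a, b)) (egl N (c, d))
  simp only [LieRing.of_associative_ring_bracket] at h
  unfold eUgl
  rw [← h]
  simp only [egl]
  rw [map_sub]
  congr 1
  · by_cases hbc : b = c
    · subst hbc; simp
    · simp [hbc]
  · by_cases had : a = d
    · subst had; simp
    · simp [had, Ne.symm had]

theorem eUgl_mul_pow_sub (N j : ℕ) (a b c d : Fin N) :
    eUgl N (a, b) * (genericMatrix N ^ j) c d - (genericMatrix N ^ j) c d * eUgl N (a, b) =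
      (if b = c then (genericMatrix N ^ j) a d else 0) -
        (if a = d then (genericMatrix N ^ j) c b else 0) := by
  induction j generalizing c d with
  | zero =>
    rw [pow_zero]
    by_cases hbc : b = c <;> by_cases had : a = d <;> by_cases hcd : c = d
    all_goals ((try subst hbc); (try subst had); (try subst hcd))
    all_goals simp_all [eq_comm]
  | succ j ih =>
    have key : ∀ x : Fin N,
        eUgl N (a, b) * ((genericMatrix N ^ j) c x * genericMatrix N x d) -
          ((genericMatrix N ^ j) c x * genericMatrix N x d) * eUgl N (a, b) =
        ((if b = c then (genericMatrix N ^ j) a x * genericMatrix N x d else 0) -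
          (if a = x then (genericMatrix N ^ j) c b * genericMatrix N x d else 0)) +
        ((if b = x then (genericMatrix N ^ j) c x * genericMatrix N a d else 0) -
          (if a = d then (genericMatrix N ^ j) c x * genericMatrix N x b else 0)) := by
      intro x
      have h1 := ih c x
      have h2 := eUgl_mul_sub N a b x d
      have e1 : eUgl N (a, b) * ((genericMatrix N ^ j) c x * genericMatrix N x d) -
          ((genericMatrix N ^ j) c x * genericMatrix N x d) * eUgl N (a, b) =
          (eUgl N (a, b) * (genericMatrix N ^ j) c x -
            (genericMatrix N ^ j) c x * eUgl N (a, b)) * genericMatrix N x d +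
          (genericMatrix N ^ j) c x * (eUgl N (a, b) * genericMatrix N x d -
            genericMatrix N x d * eUgl N (a, b)) := by noncomm_ring
      rw [e1, h1]
      simp only [genericMatrix, Matrix.of_apply] at h2 ⊢
      rw [h2, sub_mul, mul_sub]
      simp only [ite_mul, mul_ite, zero_mul, mul_zero]
    simp only [pow_succ, Matrix.mul_apply, Finset.mul_sum, Finset.sum_mul]
    rw [← Finset.sum_sub_distrib, Finset.sum_congr rfl fun x _ => key x]
    rw [Finset.sum_add_distrib, Finset.sum_sub_distrib, Finset.sum_sub_distrib]
    simp only [Finset.sum_ite_eq, Finset.mem_univ, if_true]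
    by_cases hbc : b = c <;> by_cases had : a = d <;> simp [hbc, had]; abel

theorem casimirElt_commute (N j : ℕ) (p : Fin N × Fin N) :
    Commute (eUgl N p) (casimirElt N j) := by
  obtain ⟨a, b⟩ := p
  have h : eUgl N (a, b) * casimirElt N j - casimirElt N j * eUgl N (a, b) = 0 := by
    simp only [casimirElt, Matrix.trace, Matrix.diag_apply, Finset.mul_sum, Finset.sum_mul]
    rw [← Finset.sum_sub_distrib, Finset.sum_congr rfl fun c _ => eUgl_mul_pow_sub N j a b c c]
    rw [Finset.sum_sub_distrib]
    simp
  exact sub_eq_zero.mp h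

theorem casimirElt_mem_center (N j : ℕ) : casimirElt N j ∈ Subalgebra.center ℂ (UgN N) := by
  set S : Subalgebra ℂ (UgN N) := Subalgebra.centralizer ℂ {casimirElt N j} with hS
  have hι : ∀ A : glN N, UniversalEnvelopingAlgebra.ι ℂ A ∈ S := by
    intro A
    rw [Matrix.matrix_eq_sum_single A, map_sum]
    refine Subalgebra.sum_mem _ fun a _ => ?_
    rw [map_sum]
    refine Subalgebra.sum_mem _ fun b _ => ?_
    have : Matrix.single a b (A a b) = A a b • egl N (a, b) := by simp [egl]
    rw [this, map_smul]
    refine Subalgebra.smul_mem _ ?_ _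
    rw [hS, Subalgebra.mem_centralizer_iff]
    intro g hg
    rw [Set.mem_singleton_iff.mp hg]
    exact (casimirElt_commute N j (a, b)).symm.eq
  let f : glN N →ₗ⁅ℂ⁆ S :=
    { toFun := fun A => ⟨UniversalEnvelopingAlgebra.ι ℂ A, hι A⟩
      map_add' := fun A B => Subtype.ext (by simp)
      map_smul' := fun r A => Subtype.ext (by simp)
      map_lie' := fun {A B} => Subtype.ext (by
        simp only [LieRing.of_associative_ring_bracket, Subalgebra.coe_sub, Subalgebra.coe_mul]
        exact (UniversalEnvelopingAlgebra.ι ℂ).map_lie A B) }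
  have hf : S.val.comp (UniversalEnvelopingAlgebra.lift ℂ f) = AlgHom.id ℂ (UgN N) := by
    apply UniversalEnvelopingAlgebra.hom_ext
    ext1 A
    change ((UniversalEnvelopingAlgebra.lift ℂ f (UniversalEnvelopingAlgebra.ι ℂ A) : S) : UgN N)
      = UniversalEnvelopingAlgebra.ι ℂ A
    rw [UniversalEnvelopingAlgebra.lift_ι_apply]
    rfl
  rw [Subalgebra.mem_center_iff]
  intro x
  have hx : x ∈ S := by
    have := congrArg (fun g => g x) hf
    simp only [AlgHom.comp_apply, AlgHom.id_apply] at this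
    rw [← this]
    exact Subtype.property _
  rw [hS, Subalgebra.mem_centralizer_iff] at hx
  exact (hx _ rfl).symm

/-- The generalized Casimir element `c_j`, as an element of the center `Z(U(gl(N)))`. -/
noncomputable def casimir (N j : ℕ) : Subalgebra.center ℂ (UgN N) :=
  ⟨casimirElt N j, casimirElt_mem_center N j⟩

/-- The element of `Z(U(gl(N)))` obtained from a polynomial in the variables `c_0, c_1, c_2, …` by
putting `c_0 = N` and `c_j` equal to the `j`-th generalized Casimir element. -/
noncomputable def casimirEval (N : ℕ) (P : MvPolynomial ℕ ℂ) : UgN N :=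
  (MvPolynomial.aeval (casimir N) P : Subalgebra.center ℂ (UgN N))

/-! ## The part of highest weight and the polynomial `CD` -/

/-- The subspace of `U(gl(N))` spanned by the words of length less than `u` in elements of
`gl(N)`. -/
noncomputable def wordsLT (N u : ℕ) : Submodule ℂ (UgN N) :=
  Submodule.span ℂ {w | ∃ l : List (glN N), l.length < u ∧
    w = (l.map (UniversalEnvelopingAlgebra.ι ℂ)).prod}

/-- `P ∈ ℂ[c_0, c_1, …]` is the part of highest weight of the universal `gl(N)` weight system on
`Γ`: with `u` the number of univalent vertices of `Γ`, every monomial of `P` has weight `u`, where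
`c_j` has weight `j`, and for every `N ≥ u` the weight system on `Γ` agrees with `P` up to
terms of smaller word length. -/
def Diagram.IsHighestWeightPart (Γ : Diagram) (P : MvPolynomial ℕ ℂ) : Prop :=
  MvPolynomial.IsWeightedHomogeneous (fun j : ℕ => j) P Γ.legs ∧
    ∀ N : ℕ, Γ.legs ≤ N → Γ.glWeight N - casimirEval N P ∈ wordsLT N Γ.legs

/-- The part of highest weight of the universal `gl(N)` weight system on `Γ`: the polynomial
characterized by `Diagram.IsHighestWeightPart`. -/
noncomputable def Diagram.highestWeightPart (Γ : Diagram) : MvPolynomial ℕ ℂ :=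
  Classical.epsilon Γ.IsHighestWeightPart

/-- `CD(Γ)`: the homogeneous part of highest degree of the part of highest weight, where now each
`c_j` has degree one. -/
noncomputable def Diagram.CD (Γ : Diagram) : MvPolynomial ℕ ℂ :=
  MvPolynomial.homogeneousComponent Γ.highestWeightPart.totalDegree Γ.highestWeightPart

/-! ## Pont Neuf diagrams -/

/-- The wheel with `m` legs: a circle with `m` legs attached, all pointing outwards (for `m = 0`
the circle without vertices). The half-edges at a vertex are: forward along the circle, backward,
leg. -/
def wheel (m : ℕ) : Diagram where
  V := Fin m
  L := Fin m
  E := Fin m ⊕ Fin m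
  src := Sum.elim (fun i => Sum.inl (i, 0)) (fun i => Sum.inr i)
  tgt := Sum.elim (fun i => Sum.inl (finRotate m i, 1)) (fun i => Sum.inl (i, 2))
  bijective_ends := by
    rw [Fintype.bijective_iff_surjective_and_card]
    refine ⟨?_, ?_⟩
    · rintro (⟨i, x⟩ | i)
      · fin_cases x
        · exact ⟨Sum.inl (Sum.inl i), rfl⟩
        · exact ⟨Sum.inr (Sum.inl ((finRotate m).symm i)),
            congrArg (fun j => Sum.inl (j, (1 : Fin 3))) ((finRotate m).apply_symm_apply i)⟩
        · exact ⟨Sum.inr (Sum.inr i), rfl⟩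
      · exact ⟨Sum.inl (Sum.inr i), rfl⟩
    · simp only [Fintype.card_sum, Fintype.card_prod, Fintype.card_fin]
      ring
  circles := if m = 0 then 1 else 0

namespace PontNeuf

/-- The vertices on the boundary cycle of the outer face. The cycle is made of consecutive blocks;
block `i` consists of `m i` vertices carrying a leg, followed by one junction, the vertex
`⟨i, Fin.last (m i)⟩`, from which an edge goes into the interior. -/
abbrev Outer {r : ℕ} (m : Fin r → ℕ) : Type := (i : Fin r) × Fin (m i + 1)

/-- The next vertex along the outer cycle, counterclockwise. -/
def next {r : ℕ} [NeZero r] (m : Fin r → ℕ) (c : Outer m) : Outer m :=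
  Fin.lastCases (motive := fun _ => Outer m) ⟨c.1 + 1, 0⟩ (fun j => ⟨c.1, j.succ⟩) c.2

/-- The index of the backward half-edge at a vertex of the outer cycle. The counterclockwise order
is (forward, inner edge, backward) at a junction and (forward, backward, leg) at the other
vertices, whose legs point outwards. -/
def back {r : ℕ} (m : Fin r → ℕ) (c : Outer m) : Fin 3 :=
  if c.2 = Fin.last (m c.1) then 2 else 1

/-- The index of the half-edge that does not lie on the outer cycle. -/
def side {r : ℕ} (m : Fin r → ℕ) (c : Outer m) : Fin 3 :=
  if c.2 = Fin.last (m c.1) then 1 else 2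

/-- The junction at the end of block `i`. -/
def junction {r : ℕ} (m : Fin r → ℕ) (i : Fin r) : Outer m := ⟨i, Fin.last (m i)⟩

/-- The planar diagram whose outer cycle has `n + 2` blocks with `m 0, …, m (n + 1)` legs pointing
outwards, and whose interior consists of a path `p - t_0 - t_1 - ⋯ - t_{n-1} - q` from the last
junction `p` (number `n + 1`) to the junction `q` (number `n`), each interior vertex `t_i` being
joined to junction `i`. The half-edges at `t_i` are, counterclockwise: forward along the path,
backward, towards junction `i`.

The underlying planar cubic graph has `n + 3` faces: the outer one, the face bounded by block
`n + 1` and the path, and the faces ("arches") bounded by one of the blocks `0, …, n`, a piece of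
the path and the edges between the path and the outer cycle. -/
def bridge (n : ℕ) (m : Fin (n + 2) → ℕ) : Diagram where
  V := Outer m ⊕ Fin n
  L := (i : Fin (n + 2)) × Fin (m i)
  -- edges of the outer cycle, of the path, from the path to the junctions, and legs
  E := Outer m ⊕ Fin (n + 1) ⊕ Fin n ⊕ ((i : Fin (n + 2)) × Fin (m i))
  src := Sum.elim (fun c => Sum.inl (Sum.inl c, 0)) <|
    Sum.elim (fun e => Sum.inl (Fin.cases (motive := fun _ => (Outer m ⊕ Fin n) × Fin 3)
      (Sum.inl (junction m (Fin.last (n + 1))), side m (junction m (Fin.last (n + 1))))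
      (fun i => (Sum.inr i, 0)) e)) <|
    Sum.elim (fun i => Sum.inl (Sum.inr i, 2)) (fun l => Sum.inr l)
  tgt := Sum.elim (fun c => Sum.inl (Sum.inl (next m c), back m (next m c))) <|
    Sum.elim (fun e => Sum.inl (Fin.lastCases (motive := fun _ => (Outer m ⊕ Fin n) × Fin 3)
      (Sum.inl (junction m (Fin.last n).castSucc), side m (junction m (Fin.last n).castSucc))
      (fun i => (Sum.inr i, 1)) e)) <|
    Sum.elim
      (fun i => Sum.inl (Sum.inl (junction m i.castSucc.castSucc),
        side m (junction m i.castSucc.castSucc)))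
      (fun l => Sum.inl (Sum.inl ⟨l.1, l.2.castSucc⟩, side m ⟨l.1, l.2.castSucc⟩))
  bijective_ends := by
    rw [Fintype.bijective_iff_surjective_and_card]
    refine ⟨?_, ?_⟩
    · have hnext : Function.Surjective (next m) := by
        rintro ⟨i, p⟩
        induction p using Fin.cases with
        | zero =>
          obtain ⟨j, rfl⟩ : ∃ j : Fin (n + 2), i = j + 1 := ⟨i - 1, by simp⟩
          exact ⟨junction m j, by simp only [next, junction, Fin.lastCases_last]; rfl⟩
        | succ p => exact ⟨⟨i, p.castSucc⟩, by simp [next]⟩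
      have hside : ∀ c : Outer m, ∀ x : Fin 3, x = 0 ∨ x = back m c ∨ x = side m c := by
        intro c x
        unfold back side
        split_ifs <;> revert x <;> decide
      rintro (⟨c | i, x⟩ | l)
      · rcases hside c x with h | h | h
        · exact ⟨Sum.inl (Sum.inl c), by simp [h]⟩
        · obtain ⟨c', rfl⟩ := hnext c
          exact ⟨Sum.inr (Sum.inl c'), by simp [h]⟩
        · subst h
          obtain ⟨i, p⟩ := c
          induction p using Fin.lastCases with
          | cast p => exact ⟨Sum.inr (Sum.inr (Sum.inr (Sum.inr ⟨i, p⟩))), rfl⟩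
          | last =>
            induction i using Fin.lastCases with
            | last => exact ⟨Sum.inl (Sum.inr (Sum.inl 0)), rfl⟩
            | cast i =>
              induction i using Fin.lastCases with
              | last => exact ⟨Sum.inr (Sum.inr (Sum.inl (Fin.last n))), by simp [junction]⟩
              | cast i => exact ⟨Sum.inr (Sum.inr (Sum.inr (Sum.inl i))), rfl⟩
      · fin_cases x
        · exact ⟨Sum.inl (Sum.inr (Sum.inl i.succ)), by simp⟩
        · exact ⟨Sum.inr (Sum.inr (Sum.inl i.castSucc)), by simp⟩
        · exact ⟨Sum.inl (Sum.inr (Sum.inr (Sum.inl i))), rfl⟩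
      · exact ⟨Sum.inl (Sum.inr (Sum.inr (Sum.inr l))), rfl⟩
    · simp only [Fintype.card_sum, Fintype.card_prod, Fintype.card_fin, Fintype.card_sigma,
        Finset.sum_add_distrib, Finset.sum_const, Finset.card_univ, smul_eq_mul]
      ring
  circles := 0

end PontNeuf

/-- The Pont Neuf diagram `Γ(a_1, …, a_k, b)`: a bridge with `k` arches, whose `i`-th arch carries
`a_i` legs and whose deck carries `2 b` legs. For `k = 0` it is the wheel with `2 b` legs. -/
def pontNeuf : (k : ℕ) → (Fin k → ℕ) → ℕ → Diagram
  | 0, _, b => wheel (2 * b)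
  | n + 1, a, b => PontNeuf.bridge n (Fin.snoc (α := fun _ => ℕ) a (2 * b))

/-- The set of tuples `(a_1, …, a_k, b)` with `0 ≤ a_1 ≤ ⋯ ≤ a_k ≤ b` and
`a_1 + ⋯ + a_k + 2 b = u`. -/
def pontNeufIndex (k u : ℕ) : Set ((Fin k → ℕ) × ℕ) :=
  {p | Monotone p.1 ∧ (∀ i, p.1 i ≤ p.2) ∧ ∑ i, p.1 i + 2 * p.2 = u}

/-!
The weight system is compared with polynomials in the Casimir elements by means of symbols. For a
matrix `Y`, `GlSymbol.symb Y u` is the linear functional on `U(gl(N))` that kills the words of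
length less than `u` and sends `x_1 ⋯ x_u` to the product of the values at the `x_i` of the linear
functional with coefficients `Y`. It exists because `gl(N)` acts by the vector fields `x ↦ x A`,
conjugated by `exp (s ℓ)` with a linear function `ℓ`, and the coefficient of `s ^ u` can be read
off; the Poincaré–Birkhoff–Witt theorem is not needed. Conversely, words commute up to shorter
words, so an element of filtration `u` all of whose symbols of order `u` vanish is a combination
of shorter words (`GlSymbol.mem_wordsLT_of_symb_eq_zero`).

Expanding `t([x, y], z) = tr (x y z) - tr (y x z)` at each trivalent vertex turns the weight
system into a signed sum over states. A state defines a ribbon surface, the remaining sum over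
indices is one trace `tr (Y ^ j)` for each boundary component with `j` legs, and so the state sum
`Diagram.statePoly`, with a factor `c_j` for each such component, is a part of highest weight
(`Diagram.isHighestWeightPart_statePoly`). It is the only one, since for large `N` the first
power traces of a matrix are arbitrary (`eq_zero_of_casimirEval_mem`).

For a Pont Neuf diagram with `k` arches, following the boundary along the bridge shows that there
are at most `k + 2` boundary components: three start at one end of the deck, and each rung starts
at most one more. If a sign at a vertex without leg differs from the others, two of these
components coincide (`Strip.card_le`). Hence the terms of degree `k + 2` come from the plane
embedding and its mirror image, with the legs distributed in all ways to the two adjacent faces.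
The two embeddings contribute equally as `u` is even, and `CD` is a nonzero multiple of the signed
sum `Arch.archPoly` over the distributions (`CD_pontNeuf`).

Finally, if the monomial `c_{a'_1} ⋯ c_{a'_k} c_{b'} ^ 2` occurs in the polynomial of
`(a_1, …, a_k, b)`, then `a'_i ≤ a_i` for all `i`, because at most `a_i` legs lie in the `i`-th
arch; and for `(a', b') = (a, b)` all contributions have the same sign. This triangularity gives
the linear independence (`Arch.linearIndependent_of_coeff`).
-/

/-! ### The symbol of an element of the enveloping algebra -/

namespace GlSymbol

open MvPolynomial

variable {N : ℕ}

/-- Polynomial functions of an `N × N` matrix `x`. -/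
abbrev Coord (N : ℕ) : Type := MvPolynomial (Fin N × Fin N) ℂ

/-- The linear functional `A ↦ ∑ Y i j * A i j` on `gl(N)`, which sends `e_{ij}` to `Y i j`. -/
noncomputable def pairing (Y : Matrix (Fin N) (Fin N) ℂ) : glN N →ₗ[ℂ] ℂ where
  toFun A := ∑ p : Fin N × Fin N, Y p.1 p.2 * A p.1 p.2
  map_add' A B := by simp [mul_add, Finset.sum_add_distrib]
  map_smul' c A := by
    simp only [Matrix.smul_apply, smul_eq_mul, RingHom.id_apply, Finset.mul_sum]
    exact Finset.sum_congr rfl fun _ _ => by ring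

theorem pairing_egl (Y : Matrix (Fin N) (Fin N) ℂ) (p : Fin N × Fin N) :
    pairing Y (egl N p) = Y p.1 p.2 := by
  classical
  simp only [pairing, egl, LinearMap.coe_mk, AddHom.coe_mk]
  rw [Finset.sum_eq_single p]
  · simp
  · intro q _ hq
    rw [Matrix.single_apply_of_ne, mul_zero]
    rintro ⟨h1, h2⟩
    exact hq (Prod.ext h1.symm h2.symm)
  · simp

/-- The vector field `x ↦ x A` on the space of matrices, as a derivation of its coordinate ring. -/
noncomputable def vectorField (A : glN N) : Derivation ℂ (Coord N) (Coord N) :=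
  mkDerivation ℂ fun p => ∑ k, A k p.2 • (X (p.1, k) : Coord N)

theorem vectorField_X (A : glN N) (p : Fin N × Fin N) :
    vectorField A (X p) = ∑ k, A k p.2 • (X (p.1, k) : Coord N) :=
  mkDerivation_X _ _ _

theorem vectorField_add (A B : glN N) : vectorField (A + B) = vectorField A + vectorField B := by
  refine derivation_ext fun p => ?_
  simp [vectorField_X, add_smul, Finset.sum_add_distrib]

theorem vectorField_smul (c : ℂ) (A : glN N) : vectorField (c • A) = c • vectorField A := by
  refine derivation_ext fun p => ?_
  simp [vectorField_X, mul_smul, Finset.smul_sum]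

theorem vectorField_lie (A B : glN N) :
    vectorField ⁅A, B⁆ = ⁅vectorField A, vectorField B⁆ := by
  refine derivation_ext fun p => ?_
  have key : ∀ A B : glN N, vectorField A (vectorField B (X p)) =
      ∑ k, (A * B) k p.2 • (X (p.1, k) : Coord N) := by
    intro A B
    simp only [vectorField_X, map_sum, Derivation.map_smul, Matrix.mul_apply, Finset.smul_sum,
      Finset.sum_smul]
    rw [Finset.sum_comm]
    refine Finset.sum_congr rfl fun k _ => Finset.sum_congr rfl fun l _ => ?_
    rw [smul_smul, mul_comm]
  rw [Derivation.commutator_apply, key, key, vectorField_X, ← Finset.sum_sub_distrib]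
  refine Finset.sum_congr rfl fun k _ => ?_
  rw [← sub_smul, LieRing.of_associative_ring_bracket, Matrix.sub_apply]

/-- The linear function `∑ Y i j * x i j` of a matrix `x`. -/
noncomputable def linearForm (Y : Matrix (Fin N) (Fin N) ℂ) : Coord N :=
  ∑ p : Fin N × Fin N, Y p.1 p.2 • X p

/-- The operator `D_A + s • D_A ℓ` on polynomials in a parameter `s` (encoded as the sequences of
their coefficients), where `D_A` is the vector field of `A` and `ℓ` the linear form of `Y`. It is
the conjugate of `D_A` by `exp (s ℓ)`. -/
noncomputable def shiftOp (Y : Matrix (Fin N) (Fin N) ℂ) (A : glN N) :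
    Module.End ℂ (ℕ → Coord N) where
  toFun f d := vectorField A (f d) +
    vectorField A (linearForm Y) * (if d = 0 then 0 else f (d - 1))
  map_add' f g := by
    funext d
    by_cases h : d = 0 <;> simp [h, mul_add]; ring
  map_smul' c f := by
    funext d
    by_cases h : d = 0 <;> simp [h, smul_add]

theorem shiftOp_apply (Y : Matrix (Fin N) (Fin N) ℂ) (A : glN N) (f : ℕ → Coord N) (d : ℕ) :
    shiftOp Y A f d = vectorField A (f d) +
      vectorField A (linearForm Y) * (if d = 0 then 0 else f (d - 1)) := rfl

/-- The action of `gl(N)` by the operators `D_A + s • D_A ℓ`. -/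
noncomputable def shiftRep (Y : Matrix (Fin N) (Fin N) ℂ) :
    glN N →ₗ⁅ℂ⁆ Module.End ℂ (ℕ → Coord N) where
  toFun := shiftOp Y
  map_add' A B := by
    refine LinearMap.ext fun f => funext fun d => ?_
    simp only [shiftOp_apply, vectorField_add, Derivation.add_apply, LinearMap.add_apply,
      Pi.add_apply]
    ring
  map_smul' c A := by
    refine LinearMap.ext fun f => funext fun d => ?_
    simp only [shiftOp_apply, vectorField_smul, Derivation.smul_apply, LinearMap.smul_apply,
      Pi.smul_apply, RingHom.id_apply, smul_add, smul_mul_assoc]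
  map_lie' {A B} := by
    refine LinearMap.ext fun f => funext fun d => ?_
    change _ = (shiftOp Y A * shiftOp Y B - shiftOp Y B * shiftOp Y A) f d
    simp only [LinearMap.sub_apply, Module.End.mul_apply, Pi.sub_apply, shiftOp_apply,
      vectorField_lie, Derivation.commutator_apply, map_add, Derivation.leibniz, smul_eq_mul]
    by_cases h : d = 0
    · simp [h]
    · simp only [h, if_false]
      ring

/-- The symbol of order `u`, evaluated at the matrix `Y`: a word `x₁ ⋯ x_u` of length `u` is sent
to `∏ pairing Y x_i`, and shorter words are sent to zero. The words act on the constant `1`, the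
coefficient of `s ^ u` is taken and evaluated at the identity matrix. -/
noncomputable def symb (Y : Matrix (Fin N) (Fin N) ℂ) (u : ℕ) : UgN N →ₗ[ℂ] ℂ :=
  (MvPolynomial.aeval (R := ℂ)
      (fun p : Fin N × Fin N => (1 : Matrix (Fin N) (Fin N) ℂ) p.1 p.2)).toLinearMap ∘ₗ
    LinearMap.proj u ∘ₗ LinearMap.applyₗ (Pi.single 0 1 : ℕ → Coord N) ∘ₗ
      (UniversalEnvelopingAlgebra.lift ℂ (shiftRep Y)).toLinearMap

/-- The product in the enveloping algebra of a list of elements of `gl(N)`. -/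
noncomputable def word (l : List (glN N)) : UgN N :=
  (l.map (UniversalEnvelopingAlgebra.ι ℂ)).prod

@[simp] theorem word_cons (A : glN N) (l : List (glN N)) :
    word (A :: l) = UniversalEnvelopingAlgebra.ι ℂ A * word l := by simp [word]

theorem word_append (l l' : List (glN N)) : word (l ++ l') = word l * word l' := by
  simp [word]

theorem word_mem_wordsLT {l : List (glN N)} {u : ℕ} (h : l.length < u) : word l ∈ wordsLT N u :=
  Submodule.subset_span ⟨l, h, rfl⟩

theorem vectorField_linearForm_eval (Y : Matrix (Fin N) (Fin N) ℂ) (A : glN N) :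
    MvPolynomial.aeval (R := ℂ)
      (fun p : Fin N × Fin N => (1 : Matrix (Fin N) (Fin N) ℂ) p.1 p.2)
      (vectorField A (linearForm Y)) = pairing Y A := by
  simp [linearForm, pairing, vectorField_X, Matrix.one_apply]

/-- A word of length `d` acting on `1` gives a polynomial in `s` of degree at most `d`, and each
letter contributes its multiplication part to the coefficient of `s ^ d`. -/
theorem lift_word_single (Y : Matrix (Fin N) (Fin N) ℂ) (l : List (glN N)) :
    (∀ d, l.length < d →
      UniversalEnvelopingAlgebra.lift ℂ (shiftRep Y) (word l) (Pi.single 0 1) d = 0) ∧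
    UniversalEnvelopingAlgebra.lift ℂ (shiftRep Y) (word l) (Pi.single 0 1) l.length =
      (l.map fun A => vectorField A (linearForm Y)).prod := by
  induction l with
  | nil =>
    refine ⟨fun d hd => ?_, ?_⟩
    · have : d ≠ 0 := by simpa using hd.ne'
      simp [word, this]
    · simp [word]
  | cons A l ih =>
    have step : ∀ d, UniversalEnvelopingAlgebra.lift ℂ (shiftRep Y) (word (A :: l))
        (Pi.single 0 1) d = vectorField A (UniversalEnvelopingAlgebra.lift ℂ (shiftRep Y) (word l)
          (Pi.single 0 1) d) + vectorField A (linearForm Y) * (if d = 0 then 0 else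
          UniversalEnvelopingAlgebra.lift ℂ (shiftRep Y) (word l) (Pi.single 0 1) (d - 1)) := by
      intro d
      rw [word_cons, map_mul, Module.End.mul_apply, UniversalEnvelopingAlgebra.lift_ι_apply]
      rfl
    refine ⟨fun d hd => ?_, ?_⟩
    · simp only [List.length_cons] at hd
      rw [step, ih.1 d (by omega), if_neg (by omega), ih.1 (d - 1) (by omega)]
      simp
    · rw [step, List.length_cons, ih.1 _ (Nat.lt_succ_self _)]
      simp [ih.2]

theorem symb_word_of_lt (Y : Matrix (Fin N) (Fin N) ℂ) {u : ℕ} {l : List (glN N)}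
    (h : l.length < u) : symb Y u (word l) = 0 := by
  simp [symb, (lift_word_single Y l).1 u h]

theorem symb_word (Y : Matrix (Fin N) (Fin N) ℂ) (l : List (glN N)) :
    symb Y l.length (word l) = (l.map (pairing Y)).prod := by
  simp only [symb, LinearMap.comp_apply, AlgHom.toLinearMap_apply, LinearMap.applyₗ_apply_apply,
    LinearMap.proj_apply, (lift_word_single Y l).2, map_list_prod, List.map_map]
  congr 2
  funext A
  exact vectorField_linearForm_eval Y A

theorem symb_eq_zero_of_mem (Y : Matrix (Fin N) (Fin N) ℂ) {u : ℕ} {x : UgN N}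
    (hx : x ∈ wordsLT N u) : symb Y u x = 0 := by
  have : wordsLT N u ≤ LinearMap.ker (symb Y u) := by
    refine Submodule.span_le.2 ?_
    rintro _ ⟨l, hl, rfl⟩
    exact symb_word_of_lt Y hl
  exact this hx

theorem mul_mem_wordsLT {a b : ℕ} {x y : UgN N} (hx : x ∈ wordsLT N (a + 1))
    (hy : y ∈ wordsLT N b) : x * y ∈ wordsLT N (a + b) := by
  induction hx using Submodule.span_induction with
  | zero => simp
  | add x x' _ _ h h' => rw [add_mul]; exact add_mem h h'
  | smul c x _ h => rw [smul_mul_assoc]; exact Submodule.smul_mem _ _ h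
  | mem x hx =>
    obtain ⟨l, hl, rfl⟩ := hx
    induction hy using Submodule.span_induction with
    | zero => simp
    | add x x' _ _ h h' => rw [mul_add]; exact add_mem h h'
    | smul c x _ h => rw [mul_smul_comm]; exact Submodule.smul_mem _ _ h
    | mem y hy =>
      obtain ⟨l', hl', rfl⟩ := hy
      have := word_append l l'
      unfold word at this
      rw [← this]
      exact word_mem_wordsLT (by rw [List.length_append]; omega)

theorem ι_mem_wordsLT (A : glN N) : UniversalEnvelopingAlgebra.ι ℂ A ∈ wordsLT N (1 + 1) := by
  have := word_mem_wordsLT (u := 2) (l := [A]) (by simp)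
  simpa [word] using this

theorem symb_mul (Y : Matrix (Fin N) (Fin N) ℂ) {a b : ℕ} {x y : UgN N}
    (hx : x ∈ wordsLT N (a + 1)) (hy : y ∈ wordsLT N (b + 1)) :
    symb Y (a + b) (x * y) = symb Y a x * symb Y b y := by
  induction hx using Submodule.span_induction with
  | zero => simp
  | add x x' _ _ h h' => rw [add_mul, map_add, map_add, h, h', add_mul]
  | smul c x _ h => simp [h, mul_assoc]
  | mem x hx =>
    obtain ⟨l, hl, rfl⟩ := hx
    induction hy using Submodule.span_induction with
    | zero => simp
    | add x x' _ _ h h' => rw [mul_add, map_add, map_add, h, h', mul_add]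
    | smul c x _ h =>
      simp only [mul_smul_comm, map_smul, h, smul_eq_mul]
      ring
    | mem y hy =>
      obtain ⟨l', hl', rfl⟩ := hy
      have happ := word_append l l'
      change symb Y (a + b) (word l * word l') = symb Y a (word l) * symb Y b (word l')
      rw [← happ]
      rcases Nat.lt_succ_iff_lt_or_eq.1 hl with h | rfl
      · rw [symb_word_of_lt Y h, zero_mul, symb_word_of_lt]
        rw [List.length_append]; omega
      · rcases Nat.lt_succ_iff_lt_or_eq.1 hl' with h | rfl
        · rw [symb_word_of_lt Y h, mul_zero, symb_word_of_lt]
          rw [List.length_append]; omega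
        · rw [symb_word, symb_word, ← List.length_append, symb_word, List.map_append,
            List.prod_append]

/-- Reordering a word changes it by shorter words only. -/
theorem word_sub_word_mem_of_perm {l l' : List (glN N)} (h : l.Perm l') :
    word l - word l' ∈ wordsLT N l.length := by
  induction h with
  | nil => simp
  | cons A h ih =>
    rw [word_cons, word_cons, ← mul_sub, List.length_cons, add_comm]
    exact mul_mem_wordsLT (ι_mem_wordsLT A) ih
  | swap A B l =>
    have : word (B :: A :: l) - word (A :: B :: l) = word (⁅B, A⁆ :: l) := by
      simp only [word_cons, LieHom.map_lie]
      rw [LieRing.of_associative_ring_bracket, sub_mul, mul_assoc, mul_assoc]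
    rw [this]
    exact word_mem_wordsLT (by simp)
  | trans h₁ _ ih₁ ih₂ =>
    rw [← h₁.length_eq] at ih₂
    simpa using add_mem ih₁ ih₂

/-- The product of the standard generators occurring in a monomial, in some order, extended
linearly to polynomials in the entries of a matrix. -/
noncomputable def ordered : Coord N →ₗ[ℂ] UgN N :=
  (basisMonomials (Fin N × Fin N) ℂ).constr ℂ fun m =>
    word ((Finsupp.toMultiset m).toList.map (egl N))

theorem ordered_monomial (m : Fin N × Fin N →₀ ℕ) (c : ℂ) :
    ordered (monomial m c) = c • word ((Finsupp.toMultiset m).toList.map (egl N)) := by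
  have h1 : (monomial m c : Coord N) = c • basisMonomials (Fin N × Fin N) ℂ m := by
    simp [smul_monomial]
  rw [h1, map_smul, ordered, Module.Basis.constr_basis]

theorem egl_mul_ordered_sub_mem (p : Fin N × Fin N) {u : ℕ} {f : Coord N}
    (hf : f.IsHomogeneous u) : UniversalEnvelopingAlgebra.ι ℂ (egl N p) * ordered f -
      ordered (X p * f) ∈ wordsLT N (u + 1) := by
  classical
  have hsum := f.support_sum_monomial_coeff
  rw [← hsum, Finset.mul_sum, map_sum, map_sum, Finset.mul_sum, ← Finset.sum_sub_distrib]
  refine Submodule.sum_mem _ fun m hm => ?_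
  have hXm : (X p * monomial m (coeff m f) : Coord N) =
      monomial (Finsupp.single p 1 + m) (coeff m f) := by
    rw [X, monomial_mul, one_mul]
  rw [hXm, ordered_monomial, ordered_monomial, mul_smul_comm, ← smul_sub]
  refine Submodule.smul_mem _ _ ?_
  rw [← word_cons, ← List.map_cons]
  have hperm : (p :: (Finsupp.toMultiset m).toList).Perm
      (Finsupp.toMultiset (Finsupp.single p 1 + m)).toList := by
    rw [← Multiset.coe_eq_coe, Multiset.coe_toList, ← Multiset.cons_coe, Multiset.coe_toList,
      map_add, Finsupp.toMultiset_single, one_smul, Multiset.singleton_add]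
  have hlen : (Finsupp.toMultiset m).toList.length = u := by
    rw [Multiset.length_toList, Finsupp.card_toMultiset]
    have := hf (mem_support_iff.1 hm)
    rw [Finsupp.weight_apply] at this
    simpa [Finsupp.sum] using this
  have := word_sub_word_mem_of_perm (hperm.map (egl N))
  simpa [hlen] using this

/-- The linear function on matrices `Y` whose value is `pairing Y A`. -/
noncomputable def coordForm (A : glN N) : Coord N :=
  ∑ p : Fin N × Fin N, A p.1 p.2 • X p

/-- Modulo shorter words, a word is the image of a product of linear forms. -/
theorem word_sub_ordered_mem (l : List (glN N)) :
    ((l.map coordForm).prod : Coord N).IsHomogeneous l.length ∧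
      word l - ordered (l.map coordForm).prod ∈ wordsLT N l.length := by
  induction l with
  | nil =>
    refine ⟨by simpa using isHomogeneous_one _ _, ?_⟩
    have h1 : ordered (1 : Coord N) = 1 := by
      change ordered (monomial 0 1 : Coord N) = 1
      rw [ordered_monomial]
      simp [word]
    simp [word, h1]
  | cons A l ih =>
    obtain ⟨ih1, ih2⟩ := ih
    have hA : (coordForm A).IsHomogeneous 1 :=
      IsHomogeneous.sum _ _ _ fun p _ => by
        rw [smul_eq_C_mul]
        simpa using (isHomogeneous_C _ (A p.1 p.2)).mul (isHomogeneous_X ℂ p)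
    refine ⟨by
      rw [List.map_cons, List.prod_cons, List.length_cons, add_comm]; exact hA.mul ih1, ?_⟩
    have hA' : A = ∑ p : Fin N × Fin N, A p.1 p.2 • egl N p := by
      rw [Fintype.sum_prod_type]
      refine (Matrix.matrix_eq_sum_single A).trans ?_
      refine Finset.sum_congr rfl fun i _ => Finset.sum_congr rfl fun j _ => ?_
      rw [egl, Matrix.smul_single, smul_eq_mul, mul_one]
    set f := (l.map coordForm).prod with hf
    rw [word_cons, List.map_cons, List.prod_cons, List.length_cons, ← hf]
    have e : UniversalEnvelopingAlgebra.ι ℂ A * word l - ordered (coordForm A * f) =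
        UniversalEnvelopingAlgebra.ι ℂ A * (word l - ordered f) +
        ∑ p : Fin N × Fin N, A p.1 p.2 •
          (UniversalEnvelopingAlgebra.ι ℂ (egl N p) * ordered f - ordered (X p * f)) := by
      have e1 : UniversalEnvelopingAlgebra.ι ℂ A * ordered f =
          ∑ p : Fin N × Fin N, A p.1 p.2 •
            (UniversalEnvelopingAlgebra.ι ℂ (egl N p) * ordered f) := by
        conv_lhs => rw [hA']
        simp only [map_sum, map_smul, Finset.sum_mul, smul_mul_assoc]
      have e2 : ordered (coordForm A * f) =
          ∑ p : Fin N × Fin N, A p.1 p.2 • ordered (X p * f) := by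
        simp [coordForm, Finset.sum_mul]
      rw [mul_sub, e2]
      simp only [smul_sub, Finset.sum_sub_distrib]
      rw [← e1]
      abel
    rw [e]
    refine add_mem ?_ (Submodule.sum_mem _ fun p _ => Submodule.smul_mem _ _
      (egl_mul_ordered_sub_mem p ih1))
    rw [add_comm]
    exact mul_mem_wordsLT (ι_mem_wordsLT A) ih2

theorem eval_coordForm (Y : Matrix (Fin N) (Fin N) ℂ) (A : glN N) :
    eval (fun p => Y p.1 p.2) (coordForm A) = pairing Y A := by
  simp [coordForm, pairing, smul_eval, mul_comm]

/-- Modulo shorter words, an element of filtration `u` is the image of a polynomial, and its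
symbols of order `u` are the values of this polynomial. -/
theorem exists_sub_ordered_mem {u : ℕ} {x : UgN N} (hx : x ∈ wordsLT N (u + 1)) :
    ∃ f : Coord N, x - ordered f ∈ wordsLT N u ∧
      ∀ Y : Matrix (Fin N) (Fin N) ℂ, eval (fun p => Y p.1 p.2) f = symb Y u x := by
  induction hx using Submodule.span_induction with
  | zero => exact ⟨0, by simp, by simp⟩
  | add x x' _ _ h h' =>
    obtain ⟨f, h1, h2⟩ := h
    obtain ⟨f', h1', h2'⟩ := h'
    exact ⟨f + f', by rw [map_add, add_sub_add_comm]; exact add_mem h1 h1', by simp [h2, h2']⟩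
  | smul c x _ h =>
    obtain ⟨f, h1, h2⟩ := h
    exact ⟨c • f, by rw [map_smul, ← smul_sub]; exact Submodule.smul_mem _ _ h1,
      by simp [h2, smul_eval]⟩
  | mem x hx =>
    obtain ⟨l, hl, rfl⟩ := hx
    rcases Nat.lt_succ_iff_lt_or_eq.1 hl with h | rfl
    · exact ⟨0, by rw [map_zero, sub_zero]; exact word_mem_wordsLT h, fun Y => by
        rw [map_zero]; exact (symb_word_of_lt Y h).symm⟩
    · refine ⟨(l.map coordForm).prod, (word_sub_ordered_mem l).2, fun Y => ?_⟩
      change _ = symb Y l.length (word l)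
      rw [symb_word, map_list_prod, List.map_map]
      congr 2
      funext A
      exact eval_coordForm Y A

/-- An element of the span of the words of length at most `u` all of whose symbols of order `u`
vanish lies in the span of the shorter words. -/
theorem mem_wordsLT_of_symb_eq_zero {u : ℕ} {x : UgN N} (hx : x ∈ wordsLT N (u + 1))
    (h : ∀ Y, symb Y u x = 0) : x ∈ wordsLT N u := by
  obtain ⟨f, h1, h2⟩ := exists_sub_ordered_mem hx
  have hf : f = 0 := MvPolynomial.funext fun y => by
    have := h2 (Matrix.of fun i j => y (i, j))
    rw [h] at this
    simpa using this
  simpa [hf] using h1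

/-! ### Symbols of the Casimir elements -/

theorem one_mem_wordsLT : (1 : UgN N) ∈ wordsLT N (0 + 1) := by
  simpa [word] using word_mem_wordsLT (l := ([] : List (glN N))) (u := 1) (by simp)

theorem symb_one (Y : Matrix (Fin N) (Fin N) ℂ) : symb Y 0 (1 : UgN N) = 1 := by
  simpa [word] using symb_word Y []

theorem genericMatrix_pow_apply (j : ℕ) (a b : Fin N) :
    (genericMatrix N ^ j) a b ∈ wordsLT N (j + 1) ∧
      ∀ Y, symb Y j ((genericMatrix N ^ j) a b) = (Y ^ j) a b := by
  induction j generalizing a b with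
  | zero =>
    by_cases hab : a = b
    · subst hab
      simpa [Matrix.one_apply] using ⟨one_mem_wordsLT, symb_one⟩
    · simp [hab]
  | succ j ih =>
    have he : ∀ x, genericMatrix N x b ∈ wordsLT N (1 + 1) := fun x => ι_mem_wordsLT _
    have hs : ∀ Y x, symb Y 1 (genericMatrix N x b) = Y x b := fun Y x => by
      have := symb_word Y [egl N (x, b)]
      simp only [List.length_singleton, word, List.map_cons, List.map_nil, List.prod_cons,
        List.prod_nil, mul_one, pairing_egl] at this
      exact this
    simp only [pow_succ, Matrix.mul_apply]
    refine ⟨Submodule.sum_mem _ fun x _ => mul_mem_wordsLT (b := 1 + 1) (ih a x).1 (he x),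
      fun Y => ?_⟩
    rw [map_sum]
    exact Finset.sum_congr rfl fun x _ => by
      rw [symb_mul Y (ih a x).1 (he x), (ih a x).2, hs]

theorem casimirElt_symb (j : ℕ) : casimirElt N j ∈ wordsLT N (j + 1) ∧
    ∀ Y, symb Y j (casimirElt N j) = (Y ^ j).trace := by
  simp only [casimirElt, Matrix.trace, Matrix.diag_apply, map_sum]
  exact ⟨Submodule.sum_mem _ fun a _ => (genericMatrix_pow_apply j a a).1,
    fun Y => Finset.sum_congr rfl fun a _ => (genericMatrix_pow_apply j a a).2 Y⟩

theorem casimirEval_monomial_symb (d : ℕ →₀ ℕ) :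
    casimirEval N (monomial d 1) ∈ wordsLT N (Finsupp.weight (fun j : ℕ => j) d + 1) ∧
      ∀ Y, symb Y (Finsupp.weight (fun j : ℕ => j) d) (casimirEval N (monomial d 1)) =
        eval (fun j => (Y ^ j).trace) (monomial d 1) := by
  induction d using Finsupp.induction_linear with
  | zero =>
    have h3 : casimirEval N (monomial 0 1) = 1 := by
      change casimirEval N 1 = 1
      simp [casimirEval]
    rw [h3]
    simpa using ⟨one_mem_wordsLT, symb_one⟩
  | add d d' h h' =>
    have e : (monomial (d + d') 1 : MvPolynomial ℕ ℂ) = monomial d 1 * monomial d' 1 := by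
      simp [monomial_mul]
    have e2 : casimirEval N (monomial (d + d') 1) =
        casimirEval N (monomial d 1) * casimirEval N (monomial d' 1) := by
      rw [e, casimirEval, map_mul]; rfl
    rw [e2, map_add]
    exact ⟨mul_mem_wordsLT (a := Finsupp.weight (fun j : ℕ => j) d)
      (b := Finsupp.weight (fun j : ℕ => j) d' + 1) h.1 h'.1, fun Y => by
      rw [symb_mul Y h.1 h'.1, h.2, h'.2, e, map_mul]⟩
  | single j m =>
    have e2 : casimirEval N (monomial (Finsupp.single j m) 1) = casimirElt N j ^ m := by
      rw [← X_pow_eq_monomial]; simp [casimirEval, casimir]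
    have e3 : ∀ Y : Matrix (Fin N) (Fin N) ℂ, eval (fun j => (Y ^ j).trace)
        (monomial (Finsupp.single j m) 1) = (Y ^ j).trace ^ m := fun Y => by
      rw [← X_pow_eq_monomial, map_pow, eval_X]
    simp only [e2, e3]
    have hw : Finsupp.weight (fun j : ℕ => j) (Finsupp.single j m) = m * j := by
      simp [Finsupp.weight_apply]
    rw [hw]
    clear e2 e3 hw
    induction m with
    | zero =>
      simpa using ⟨one_mem_wordsLT, symb_one⟩
    | succ m ih =>
      rw [pow_succ, add_mul, one_mul]
      exact ⟨mul_mem_wordsLT (b := j + 1) ih.1 (casimirElt_symb j).1, fun Y => by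
        rw [symb_mul Y ih.1 (casimirElt_symb j).1, ih.2, (casimirElt_symb j).2, pow_succ]⟩

/-- The symbol of order `u` of a polynomial of weight `u` in the Casimir elements is the value of
the polynomial at the power traces. -/
theorem casimirEval_symb {u : ℕ} {P : MvPolynomial ℕ ℂ}
    (hP : IsWeightedHomogeneous (fun j : ℕ => j) P u) :
    casimirEval N P ∈ wordsLT N (u + 1) ∧
      ∀ Y, symb Y u (casimirEval N P) = eval (fun j => (Y ^ j).trace) P := by
  have e : casimirEval N P = ∑ d ∈ P.support, coeff d P • casimirEval N (monomial d 1) := by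
    conv_lhs => rw [← P.support_sum_monomial_coeff]
    simp only [casimirEval, map_sum, AddSubmonoidClass.coe_finsetSum]
    refine Finset.sum_congr rfl fun d _ => ?_
    have : (monomial d (coeff d P) : MvPolynomial ℕ ℂ) = coeff d P • monomial d 1 := by
      simp [smul_monomial]
    rw [this, map_smul]
    rfl
  have hw : ∀ d ∈ P.support, Finsupp.weight (fun j : ℕ => j) d = u := fun d hd =>
    hP (mem_support_iff.1 hd)
  rw [e]
  refine ⟨Submodule.sum_mem _ fun d hd => Submodule.smul_mem _ _ ?_, fun Y => ?_⟩
  · rw [← hw d hd]; exact (casimirEval_monomial_symb d).1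
  · conv_rhs => rw [← P.support_sum_monomial_coeff]
    rw [map_sum, map_sum]
    refine Finset.sum_congr rfl fun d hd => ?_
    have : (monomial d (coeff d P) : MvPolynomial ℕ ℂ) = coeff d P • monomial d 1 := by
      simp [smul_monomial]
    rw [this, map_smul, smul_eval, ← (casimirEval_monomial_symb d).2 Y, hw d hd]
    rfl

end GlSymbol

/-! ### Traces over permutations -/

namespace Trace

variable {n : Type*} [Fintype n] [DecidableEq n]

/-- Summing over all paths `x, i 0, …, i (m - 1)` computes a product of matrices. -/
theorem sum_path (Y : Matrix n n ℂ) (m : ℕ) (e : Fin m → ℕ) (x : n) (v : n → ℂ) :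
    ∑ i : Fin m → n, (∏ j : Fin m, (Y ^ e j) (i j) ((Fin.cons x i : Fin (m + 1) → n) j.castSucc)) *
      v ((Fin.cons x i : Fin (m + 1) → n) (Fin.last m)) = ∑ z, v z * (Y ^ ∑ j, e j) z x := by
  induction m generalizing x with
  | zero => simp [Matrix.one_apply]
  | succ m ih =>
    rw [← (Fin.consEquiv fun _ : Fin (m + 1) => n).sum_comp, Fintype.sum_prod_type]
    have h : ∀ y : n, ∑ i : Fin m → n,
        (∏ j : Fin (m + 1), (Y ^ e j) ((Fin.cons y i : Fin (m + 1) → n) j)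
          ((Fin.cons x (Fin.cons y i : Fin (m + 1) → n) : Fin (m + 2) → n) j.castSucc)) *
          v ((Fin.cons x (Fin.cons y i : Fin (m + 1) → n) : Fin (m + 2) → n) (Fin.last (m + 1))) =
        (∑ z, v z * (Y ^ ∑ j : Fin m, e j.succ) z y) * (Y ^ e 0) y x := by
      intro y
      rw [← ih (fun j => e j.succ) y, Finset.sum_mul]
      refine Finset.sum_congr rfl fun i _ => ?_
      rw [Fin.prod_univ_succ]
      simp only [Fin.cons_zero, Fin.cons_succ, Fin.castSucc_zero, ← Fin.succ_castSucc,
        ← Fin.succ_last]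
      ring
    refine (Finset.sum_congr rfl fun y _ => h y).trans ?_
    simp only [Finset.sum_mul]
    rw [Finset.sum_comm]
    refine Finset.sum_congr rfl fun z _ => ?_
    rw [Fin.sum_univ_succ, add_comm (e 0), pow_add, Matrix.mul_apply, Finset.mul_sum]
    exact Finset.sum_congr rfl fun y _ => by ring

/-- Summing over all closed paths computes a trace. -/
theorem sum_closed_path (Y : Matrix n n ℂ) (m : ℕ) (e : Fin (m + 1) → ℕ) :
    ∑ i : Fin (m + 1) → n, ∏ j, (Y ^ e j) (i (finRotate (m + 1) j)) (i j) =
      (Y ^ ∑ j, e j).trace := by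
  rw [← (Fin.consEquiv fun _ : Fin (m + 1) => n).sum_comp, Fintype.sum_prod_type, Matrix.trace]
  refine Finset.sum_congr rfl fun x _ => ?_
  rw [Matrix.diag_apply, Fin.sum_univ_castSucc, add_comm _ (e (Fin.last m)), pow_add,
    Matrix.mul_apply]
  rw [← sum_path Y m (fun j => e j.castSucc) x fun z => (Y ^ e (Fin.last m)) x z]
  refine Finset.sum_congr rfl fun i _ => ?_
  rw [Fin.prod_univ_castSucc]
  simp [Fin.consEquiv]

/-- The cycles of a permutation, fixed points included. -/
abbrev Cycles {H : Type*} (ρ : Equiv.Perm H) : Type _ :=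
  Quotient (Equiv.Perm.SameCycle.setoid ρ)

noncomputable instance {H : Type*} [Finite H] (ρ : Equiv.Perm H) : Fintype (Cycles ρ) :=
  Fintype.ofFinite _

noncomputable instance {H : Type*} (ρ : Equiv.Perm H) : DecidableEq (Cycles ρ) :=
  Classical.decEq _

/-- The cycle of an element. -/
def cyc {H : Type*} (ρ : Equiv.Perm H) (h : H) : Cycles ρ := Quotient.mk _ h

theorem cyc_eq_iff {H : Type*} {ρ : Equiv.Perm H} {h h' : H} :
    cyc ρ h = cyc ρ h' ↔ ρ.SameCycle h h' := Quotient.eq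

theorem cyc_apply {H : Type*} (ρ : Equiv.Perm H) (h : H) : cyc ρ (ρ h) = cyc ρ h :=
  cyc_eq_iff.2 (Equiv.Perm.sameCycle_apply_left.2 (Equiv.Perm.SameCycle.refl _ _))

theorem cyc_surjective {H : Type*} (ρ : Equiv.Perm H) : Function.Surjective (cyc ρ) :=
  Quotient.mk_surjective

variable {H : Type*} [Fintype H]

/-- The elements of a cycle can be numbered so that the permutation becomes a rotation. -/
theorem exists_equiv_fin (ρ : Equiv.Perm H) (h₀ : H) :
    ∃ (m : ℕ) (f : Fin (m + 1) ≃ {h : H // cyc ρ h = cyc ρ h₀}),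
      ∀ j, ρ (f j) = f (finRotate (m + 1) j) := by
  classical
  set p := Function.minimalPeriod ρ h₀ with hp
  have hpos : 0 < p := Function.minimalPeriod_pos_of_mem_periodicPts
    ((Function.Injective.mem_periodicPts ρ.injective) h₀)
  obtain ⟨m, hm⟩ : ∃ m, p = m + 1 := ⟨p - 1, by omega⟩
  have hmem : ∀ j : ℕ, cyc ρ ((ρ ^ j) h₀) = cyc ρ h₀ := fun j =>
    cyc_eq_iff.2 (Equiv.Perm.sameCycle_pow_left.2 (Equiv.Perm.SameCycle.refl _ _))
  have hper : (ρ ^ (m + 1)) h₀ = h₀ := by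
    rw [← hm, Equiv.Perm.coe_pow, hp]
    exact Function.iterate_minimalPeriod
  refine ⟨m, Equiv.ofBijective (fun j => ⟨(ρ ^ (j : ℕ)) h₀, hmem j⟩) ⟨?_, ?_⟩, ?_⟩
  · intro j j' h
    have h1 : (ρ ^ (j : ℕ)) h₀ = (ρ ^ (j' : ℕ)) h₀ := congrArg Subtype.val h
    rw [Equiv.Perm.coe_pow, Equiv.Perm.coe_pow] at h1
    refine Fin.ext (Function.iterate_injOn_Iio_minimalPeriod (f := ρ) (x := h₀) ?_ ?_ h1)
    · rw [Set.mem_Iio, ← hp, hm]; exact j.2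
    · rw [Set.mem_Iio, ← hp, hm]; exact j'.2
  · rintro ⟨h, hh⟩
    obtain ⟨k, hk⟩ := (cyc_eq_iff.1 hh).symm.exists_nat_pow_eq
    refine ⟨⟨k % (m + 1), Nat.mod_lt _ (Nat.succ_pos _)⟩, Subtype.ext ?_⟩
    change (ρ ^ (k % (m + 1))) h₀ = h
    rw [← hk, Equiv.Perm.coe_pow, Equiv.Perm.coe_pow, ← hm, hp,
      Function.iterate_mod_minimalPeriod_eq]
  · intro j
    change ρ ((ρ ^ (j : ℕ)) h₀) = (ρ ^ ((finRotate (m + 1) j : Fin (m + 1)) : ℕ)) h₀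
    rw [← Equiv.Perm.mul_apply, ← pow_succ']
    induction j using Fin.lastCases with
    | last => rw [finRotate_last, Fin.val_last, hper]; rfl
    | cast j => rw [finRotate_apply, Fin.coeSucc_eq_succ]; rfl

/-- Contracting powers of a matrix along a permutation gives one trace for each cycle. -/
theorem sum_prod_perm [DecidableEq H] (Y : Matrix n n ℂ) (ρ : Equiv.Perm H) (e : H → ℕ) :
    ∑ i : H → n, ∏ h, (Y ^ e h) (i (ρ h)) (i h) =
      ∏ q : Cycles ρ, (Y ^ ∑ h : {h // cyc ρ h = q}, e h).trace := by
  have hq : ∀ q : Cycles ρ, (Y ^ ∑ h : {h // cyc ρ h = q}, e h).trace =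
      ∑ i : {h // cyc ρ h = q} → n, ∏ h : {h // cyc ρ h = q},
        (Y ^ e h) (i ⟨ρ h, (cyc_apply ρ h).trans h.2⟩) (i h) := by
    intro q
    obtain ⟨h₀, rfl⟩ := cyc_surjective ρ q
    obtain ⟨m, f, hf⟩ := exists_equiv_fin ρ h₀
    rw [← f.sum_comp, ← sum_closed_path Y m fun j => e (f j),
      ← (f.arrowCongr (Equiv.refl n)).sum_comp]
    refine Finset.sum_congr rfl fun i _ => ?_
    rw [← f.prod_comp]
    refine Finset.prod_congr rfl fun j _ => ?_
    have : (⟨ρ (f j), (cyc_apply ρ (f j)).trans (f j).2⟩ : {h // cyc ρ h = cyc ρ h₀}) =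
        f (finRotate (m + 1) j) := Subtype.ext (hf j)
    rw [this]
    simp [Equiv.arrowCongr]
  rw [Finset.prod_congr rfl fun q _ => hq q, Finset.prod_univ_sum, Fintype.piFinset_univ]
  let E : (∀ q : Cycles ρ, {h // cyc ρ h = q} → n) ≃ (H → n) :=
    (Equiv.piCurry fun (q : Cycles ρ) (_ : {h // cyc ρ h = q}) => n).symm.trans
      ((Equiv.sigmaFiberEquiv (cyc ρ)).arrowCongr (Equiv.refl n))
  have hE : ∀ i (q : Cycles ρ) (h : {h // cyc ρ h = q}), E i h = i q h := by
    rintro i _ ⟨h, rfl⟩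
    rfl
  rw [← E.sum_comp]
  refine Finset.sum_congr rfl fun i _ => ?_
  rw [← (Equiv.sigmaFiberEquiv (cyc ρ)).prod_comp, Fintype.prod_sigma]
  refine Finset.prod_congr rfl fun q _ => Finset.prod_congr rfl fun h _ => ?_
  have h1 := hE i q h
  have h2 := hE i q ⟨ρ h, (cyc_apply ρ h).trans h.2⟩
  change (Y ^ e h) (E i (ρ h)) (E i h) = _
  rw [h1, ← h2]

end Trace

/-! ### The state sum for the part of highest weight -/

open MvPolynomial Trace GlSymbol

/-- The sign `±1` encoded by a Boolean. -/
def boolSign (b : Bool) : ℂ := if b then 1 else -1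

theorem boolSign_not (b : Bool) : boolSign (!b) = -boolSign b := by cases b <;> simp [boolSign]

theorem boolSign_mul_self (b : Bool) : boolSign b * boolSign b = 1 := by
  cases b <;> simp [boolSign]

/-- The Kronecker symbol. -/
def kronecker {N : ℕ} (a b : Fin N) : ℂ := if a = b then 1 else 0

theorem structureTensor_egl {N : ℕ} (a b c : Fin N × Fin N) :
    structureTensor (egl N a) (egl N b) (egl N c) =
      kronecker b.1 a.2 * kronecker c.1 b.2 *
          kronecker a.1 c.2 -
        kronecker c.1 a.2 * kronecker a.1 b.2 *
          kronecker b.1 c.2 := by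
  have key : ∀ a b c : Fin N × Fin N, (egl N a * egl N b * egl N c).trace =
      kronecker b.1 a.2 * kronecker c.1 b.2 *
          kronecker a.1 c.2 := by
    rintro ⟨a, a'⟩ ⟨b, b'⟩ ⟨c, c'⟩
    simp only [egl, kronecker]
    by_cases h1 : a' = b
    · subst h1
      by_cases h2 : b' = c
      · subst h2
        by_cases h3 : a = c'
        · subst h3; simp [Matrix.trace_single_eq_same]
        · simp [h3, Matrix.trace_single_eq_of_ne]
      · simp [h2, Ne.symm h2]
    · simp [h1, Ne.symm h1]
  rw [structureTensor, LieRing.of_associative_ring_bracket, sub_mul, Matrix.trace_sub, key, key]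
  ring

namespace Diagram

variable (Γ : Diagram)

/-- The two ends of the edges are all the half-edges. -/
noncomputable def ends : Γ.E ⊕ Γ.E ≃ Γ.HalfEdge := Equiv.ofBijective _ Γ.bijective_ends

/-- The involution exchanging the two halves of each edge. -/
noncomputable def opp : Equiv.Perm Γ.HalfEdge :=
  Γ.ends.symm.trans ((Equiv.sumComm Γ.E Γ.E).trans Γ.ends)

theorem opp_src (e : Γ.E) : Γ.opp (Γ.src e) = Γ.tgt e := by
  have : Γ.ends.symm (Γ.src e) = Sum.inl e := Γ.ends.symm_apply_eq.2 rfl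
  simp only [opp, Equiv.trans_apply, this]
  rfl

theorem opp_tgt (e : Γ.E) : Γ.opp (Γ.tgt e) = Γ.src e := by
  have : Γ.ends.symm (Γ.tgt e) = Sum.inr e := Γ.ends.symm_apply_eq.2 rfl
  simp only [opp, Equiv.trans_apply, this]
  rfl

variable {Γ} in
theorem halfEdge_cases {p : Γ.HalfEdge → Prop} (hs : ∀ e, p (Γ.src e)) (ht : ∀ e, p (Γ.tgt e))
    (h : Γ.HalfEdge) : p h := by
  obtain ⟨e | e, rfl⟩ := Γ.bijective_ends.2 h
  exacts [hs e, ht e]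

theorem opp_opp (h : Γ.HalfEdge) : Γ.opp (Γ.opp h) = h :=
  halfEdge_cases (p := fun h => Γ.opp (Γ.opp h) = h) (fun e => by rw [opp_src, opp_tgt])
    (fun e => by rw [opp_tgt, opp_src]) h

variable {Γ}

/-- A state assigns a Boolean to each trivalent vertex; it stands for the choice of one of the two
terms of `t([x, y], z) = tr (x y z) - tr (y x z)`. Accordingly this permutation rotates the
half-edges at each trivalent vertex forwards or backwards. It fixes the half-edges of the
univalent vertices. -/
def turn (s : Γ.V → Bool) : Equiv.Perm Γ.HalfEdge :=
  Equiv.sumCongr (Equiv.prodShear (Equiv.refl Γ.V)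
    fun v => if s v then Equiv.addRight 1 else Equiv.subRight 1) (Equiv.refl Γ.L)

theorem turn_inl (s : Γ.V → Bool) (v : Γ.V) (k : Fin 3) :
    turn s (Sum.inl (v, k)) = Sum.inl (v, if s v then k + 1 else k - 1) := by
  by_cases h : s v <;> simp [turn, h]

theorem turn_inr (s : Γ.V → Bool) (l : Γ.L) : turn s (Sum.inr l) = Sum.inr l := rfl

/-- The boundary walk of the ribbon surface defined by a state: cross the edge and turn. -/
noncomputable def walk (s : Γ.V → Bool) : Equiv.Perm Γ.HalfEdge := Γ.opp.trans (turn s)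

/-- The boundary component through a half-edge. -/
noncomputable abbrev face (s : Γ.V → Bool) (h : Γ.HalfEdge) : Cycles (walk s) := cyc (walk s) h

theorem face_opp (s : Γ.V → Bool) (h : Γ.HalfEdge) : face s (Γ.opp h) = face s (turn s h) := by
  have := cyc_apply (walk s) (Γ.opp h)
  rw [show walk s (Γ.opp h) = turn s h by rw [walk, Equiv.trans_apply, opp_opp]] at this
  exact this.symm

/-- A function on the half-edges that is constant along the boundary walk factors through the
boundary components. -/
theorem exists_factor_face {F : Type*} {s : Γ.V → Bool} {f : Γ.HalfEdge → F}
    (hf : ∀ h, f (Γ.opp h) = f (turn s h)) :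
    ∃ g : Cycles (walk s) → F, ∀ h, g (face s h) = f h := by
  have h1 : ∀ h, f (walk s h) = f h := fun h => by
    rw [walk, Equiv.trans_apply, ← hf, opp_opp]
  refine ⟨Quotient.lift f fun a b hab => ?_, fun h => rfl⟩
  obtain ⟨k, rfl⟩ := (show (walk s).SameCycle a b from hab).exists_nat_pow_eq
  clear hab
  induction k with
  | zero => rfl
  | succ k ih => rw [pow_succ', Equiv.Perm.mul_apply, h1, ih]

/-- The number of univalent vertices on a boundary component. -/
noncomputable def legCount (s : Γ.V → Bool) (q : Cycles (walk s)) : ℕ :=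
  (Finset.univ.filter fun l : Γ.L => face s (Sum.inr l) = q).card

/-- The sign of a state. -/
def stateSign (s : Γ.V → Bool) : ℂ := ∏ v, boolSign (s v)

/-- The monomial of a state: a factor `c_j` for each boundary component with `j` legs. -/
noncomputable def stateMonomial (s : Γ.V → Bool) : MvPolynomial ℕ ℂ :=
  ∏ q : Cycles (walk s), X (legCount s q)

variable (Γ) in
/-- The sum over all states of the signed monomials; each closed component without vertices
contributes `N ^ 2 = c_0 ^ 2`. -/
noncomputable def statePoly : MvPolynomial ℕ ℂ :=
  X 0 ^ (2 * Γ.circles) * ∑ s : Γ.V → Bool, stateSign s • stateMonomial s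

theorem sum_legCount (s : Γ.V → Bool) : ∑ q, legCount s q = Γ.legs := by
  unfold legCount legs
  rw [← Finset.card_univ]
  exact (Finset.card_eq_sum_card_fiberwise fun _ _ => Finset.mem_univ _).symm

theorem statePoly_isWeightedHomogeneous :
    IsWeightedHomogeneous (fun j : ℕ => j) (statePoly Γ) Γ.legs := by
  have h0 : IsWeightedHomogeneous (fun j : ℕ => j) (X 0 ^ (2 * Γ.circles) : MvPolynomial ℕ ℂ)
      0 := by
    simpa using (isWeightedHomogeneous_X ℂ (fun j : ℕ => j) 0).pow (2 * Γ.circles)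
  rw [← zero_add Γ.legs]
  refine h0.mul (IsWeightedHomogeneous.sum _ _ _ fun s _ => ?_)
  rw [smul_eq_C_mul, ← zero_add Γ.legs, ← sum_legCount s]
  exact (isWeightedHomogeneous_C _ _).mul
    (IsWeightedHomogeneous.prod _ _ _ fun q _ => isWeightedHomogeneous_X ℂ (fun j : ℕ => j) _)

/-- The sum over the indices of a state is a product of traces over the boundary components. -/
theorem sum_prod_turn {N : ℕ} (Y : Matrix (Fin N) (Fin N) ℂ) (s : Γ.V → Bool) :
    ∑ i : Γ.HalfEdge → Fin N,
      (∏ v : Γ.V, ∏ k : Fin 3, kronecker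
          (i (turn s (Sum.inl (v, k)))) (i (Γ.opp (Sum.inl (v, k))))) *
        ∏ l : Γ.L, Y (i (Sum.inr l)) (i (Γ.opp (Sum.inr l))) =
    ∏ q : Cycles (walk s), (Y ^ legCount s q).trace := by
  set e : Γ.HalfEdge → ℕ := Sum.elim (fun _ => 0) (fun _ => 1) with he
  have h1 : ∀ i : Γ.HalfEdge → Fin N,
      (∏ v : Γ.V, ∏ k : Fin 3, kronecker
          (i (turn s (Sum.inl (v, k)))) (i (Γ.opp (Sum.inl (v, k))))) *
        ∏ l : Γ.L, Y (i (Sum.inr l)) (i (Γ.opp (Sum.inr l))) =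
      ∏ h, (Y ^ e (Γ.opp h)) (i (walk s h)) (i h) := by
    intro i
    rw [← Equiv.prod_comp Γ.opp, Fintype.prod_sum_type, Fintype.prod_prod_type]
    simp [walk, opp_opp, he, turn_inr, kronecker, Matrix.one_apply]
  rw [Finset.sum_congr rfl fun i _ => h1 i, sum_prod_perm]
  refine Finset.prod_congr rfl fun q _ => ?_
  congr 2
  have h2 : ∑ h : {h // cyc (walk s) h = q}, e (Γ.opp h) =
      ∑ h, if cyc (walk s) h = q then e (Γ.opp h) else 0 := by
    rw [← Finset.sum_filter]
    exact (Finset.sum_subtype (Finset.univ.filter fun h => cyc (walk s) h = q)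
      (p := fun h => cyc (walk s) h = q) (by simp) fun h => e (Γ.opp h)).symm
  rw [h2, ← Equiv.sum_comp Γ.opp, Fintype.sum_sum_type, legCount, Finset.card_filter]
  simp only [opp_opp, he, Sum.elim_inl, Sum.elim_inr, ite_self, Finset.sum_const_zero, zero_add]
  refine Finset.sum_congr rfl fun l _ => ?_
  rw [show cyc (walk s) (Γ.opp (Sum.inr l)) = face s (Sum.inr l) from face_opp s _]

theorem IsLabeling.apply_opp {N : ℕ} {ℓ : Γ.HalfEdge → Fin N × Fin N} (h : Γ.IsLabeling N ℓ)
    (x : Γ.HalfEdge) : ℓ (Γ.opp x) = (ℓ x).swap :=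
  halfEdge_cases (p := fun x => ℓ (Γ.opp x) = (ℓ x).swap) (fun e => by rw [opp_src, h e])
    (fun e => by rw [opp_tgt, h e, Prod.swap_swap]) x

open Classical in
/-- A labeling is determined by the first indices, which are arbitrary. -/
theorem sum_labeling {M : Type*} [AddCommMonoid M] (N : ℕ)
    (g : (Γ.HalfEdge → Fin N × Fin N) → M) :
    ∑ ℓ : Γ.HalfEdge → Fin N × Fin N with Γ.IsLabeling N ℓ, g ℓ =
      ∑ i : Γ.HalfEdge → Fin N, g fun h => (i h, i (Γ.opp h)) := by
  refine Finset.sum_nbij' (fun ℓ h => (ℓ h).1) (fun i h => (i h, i (Γ.opp h))) (by simp) ?_ ?_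
    (by simp) ?_
  · intro i _
    rw [Finset.mem_filter]
    refine ⟨Finset.mem_univ _, fun e => ?_⟩
    simp [opp_src, opp_tgt]
  · intro ℓ hℓ
    funext x
    have := IsLabeling.apply_opp (Finset.mem_filter.1 hℓ).2 x
    simp [this]
  · intro ℓ hℓ
    congr 1
    funext x
    have := IsLabeling.apply_opp (Finset.mem_filter.1 hℓ).2 x
    simp [this]

theorem structureTensor_eq_sum {N : ℕ} (i : Γ.HalfEdge → Fin N) (v : Γ.V) :
    structureTensor (egl N (i (Sum.inl (v, 0)), i (Γ.opp (Sum.inl (v, 0)))))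
      (egl N (i (Sum.inl (v, 1)), i (Γ.opp (Sum.inl (v, 1)))))
      (egl N (i (Sum.inl (v, 2)), i (Γ.opp (Sum.inl (v, 2))))) =
    ∑ b : Bool, boolSign b * ∏ k : Fin 3, kronecker
      (i (Sum.inl (v, if b then k + 1 else k - 1))) (i (Γ.opp (Sum.inl (v, k)))) := by
  have e1 : (2 : Fin 3) + 1 = 0 := rfl
  have e2 : (0 : Fin 3) - 1 = 2 := rfl
  have e3 : (2 : Fin 3) - 1 = 1 := rfl
  have e4 : (1 : Fin 3) + 1 = 2 := rfl
  rw [structureTensor_egl]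
  simp [boolSign, Fin.prod_univ_three, e1, e2, e3, e4]
  ring

theorem word_ofFn {N m : ℕ} (f : Fin m → Fin N × Fin N) :
    (List.ofFn fun t => eUgl N (f t)).prod = word (List.ofFn fun t => egl N (f t)) := by
  rw [word, List.map_ofFn]
  rfl

/-- The symbol of the weight system on a diagram is the state sum evaluated at power traces. -/
theorem glWeight_symb (N : ℕ) : Γ.glWeight N ∈ wordsLT N (Γ.legs + 1) ∧
    ∀ Y, symb Y Γ.legs (Γ.glWeight N) = eval (fun j => (Y ^ j).trace) (statePoly Γ) := by
  classical
  refine ⟨?_, fun Y => ?_⟩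
  · refine Submodule.smul_mem _ _ (Submodule.smul_mem _ _ (Submodule.sum_mem _ fun o _ =>
      Submodule.sum_mem _ fun ℓ _ => Submodule.smul_mem _ _ ?_))
    rw [word_ofFn]
    exact word_mem_wordsLT (by simp)
  · have hword : ∀ (o : Fin Γ.legs ≃ Γ.L) (ℓ : Γ.HalfEdge → Fin N × Fin N),
        symb Y Γ.legs (List.ofFn fun t => eUgl N (ℓ (Sum.inr (o t)))).prod =
          ∏ l : Γ.L, Y (ℓ (Sum.inr l)).1 (ℓ (Sum.inr l)).2 := by
      intro o ℓ
      rw [word_ofFn]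
      have := symb_word Y (List.ofFn fun t => egl N (ℓ (Sum.inr (o t))))
      rw [List.length_ofFn, List.map_ofFn, List.prod_ofFn] at this
      rw [this, ← o.prod_comp]
      exact Finset.prod_congr rfl fun t _ => pairing_egl Y _
    have hcard : Fintype.card (Fin Γ.legs ≃ Γ.L) = Γ.legs.factorial := by
      change Fintype.card (Fin (Fintype.card Γ.L) ≃ Γ.L) = (Fintype.card Γ.L).factorial
      rw [Fintype.card_equiv (Fintype.equivFinOfCardEq (α := Γ.L) rfl).symm, Fintype.card_fin]
    have hfac : (Γ.legs.factorial : ℂ) ≠ 0 := Nat.cast_ne_zero.2 (Nat.factorial_ne_zero _)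
    simp only [glWeight, map_smul, map_sum, hword, Finset.sum_const, Finset.card_univ, hcard,
      smul_eq_mul, nsmul_eq_mul]
    rw [inv_mul_cancel_left₀ hfac, sum_labeling]
    simp only [statePoly, map_mul, map_pow, eval_X, pow_zero, Matrix.trace_one, Fintype.card_fin,
      map_sum, smul_eval, pow_mul, stateMonomial, map_prod]
    congr 1
    simp only [structureTensor_eq_sum]
    simp only [Finset.prod_univ_sum, Fintype.piFinset_univ, Finset.sum_mul,
      Finset.prod_mul_distrib]
    rw [Finset.sum_comm]
    refine Finset.sum_congr rfl fun s _ => ?_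
    rw [← sum_prod_turn Y s, Finset.mul_sum]
    refine Finset.sum_congr rfl fun i _ => ?_
    simp only [turn_inl, stateSign, mul_assoc]

end Diagram

/-! ### Power traces and uniqueness -/

/-- Multisets of complex numbers of a fixed size with prescribed power sums. The size is
`1 + 2 + ⋯ + u`: the roots of unity of order `j` adjust the `j`-th power sum and do not influence
the previous ones. -/
theorem exists_multiset_power_sums (u : ℕ) : ∃ n : ℕ, ∀ x : ℕ → ℂ, ∃ M : Multiset ℂ,
    M.card = n ∧ ∀ j, 1 ≤ j → j ≤ u → (M.map fun y => y ^ j).sum = x j := by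
  induction u with
  | zero => exact ⟨0, fun x => ⟨0, rfl, fun j h1 h2 => by omega⟩⟩
  | succ u ih =>
    obtain ⟨n, hn⟩ := ih
    refine ⟨n + (u + 1), fun x => ?_⟩
    obtain ⟨M, hM, hx⟩ := hn x
    set r : ℂ := (x (u + 1) - (M.map fun y => y ^ (u + 1)).sum) / (u + 1 : ℕ) with hr
    obtain ⟨z, hz⟩ := IsAlgClosed.exists_pow_nat_eq r (Nat.succ_pos u)
    obtain ⟨ζ, hζ⟩ : ∃ ζ : ℂ, IsPrimitiveRoot ζ (u + 1) :=
      ⟨_, Complex.isPrimitiveRoot_exp (u + 1) (Nat.succ_ne_zero u)⟩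
    have hsum : ∀ j, (((Multiset.range (u + 1)).map fun t => z * ζ ^ t).map fun y => y ^ j).sum =
        z ^ j * ∑ t ∈ Finset.range (u + 1), (ζ ^ j) ^ t := by
      intro j
      rw [Multiset.map_map, Finset.mul_sum, Finset.sum, Finset.range_val]
      refine congrArg _ (Multiset.map_congr rfl fun t _ => ?_)
      simp only [Function.comp_apply, mul_pow, ← pow_mul, mul_comm]
    refine ⟨M + (Multiset.range (u + 1)).map fun t => z * ζ ^ t,
      by simp [hM, add_assoc], fun j h1 h2 => ?_⟩
    rw [Multiset.map_add, Multiset.sum_add, hsum]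
    rcases Nat.lt_or_ge u j with h | h
    · obtain rfl : j = u + 1 := by omega
      have : ((u + 1 : ℕ) : ℂ) ≠ 0 := Nat.cast_ne_zero.2 (Nat.succ_ne_zero u)
      rw [hζ.pow_eq_one, hz]
      simp only [one_pow, Finset.sum_const, Finset.card_range, nsmul_eq_mul, mul_one]
      rw [hr, div_mul_cancel₀ _ this]
      ring
    · have h3 : ζ ^ j ≠ 1 := hζ.pow_ne_one_of_pos_of_lt (by omega) (by omega)
      have h4 := mul_geom_sum (ζ ^ j) (u + 1)
      rw [← pow_mul, mul_comm j, pow_mul, hζ.pow_eq_one, one_pow, sub_self] at h4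
      rw [(mul_eq_zero.1 h4).resolve_left (sub_ne_zero.2 h3), mul_zero, add_zero, hx j h1 h]

/-- For large `N` the first power traces of an `N × N` matrix are arbitrary. -/
theorem exists_matrix_power_traces (u : ℕ) : ∃ n : ℕ, ∀ N, n ≤ N → ∀ x : ℕ → ℂ,
    ∃ Y : Matrix (Fin N) (Fin N) ℂ, ∀ j, 1 ≤ j → j ≤ u → (Y ^ j).trace = x j := by
  obtain ⟨n, hn⟩ := exists_multiset_power_sums u
  refine ⟨n, fun N hN x => ?_⟩
  obtain ⟨M, hM, hx⟩ := hn x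
  obtain ⟨l, hl⟩ : ∃ l, l = (M + Multiset.replicate (N - n) 0).toList := ⟨_, rfl⟩
  have hlen : l.length = N := by
    rw [hl, Multiset.length_toList, Multiset.card_add, hM, Multiset.card_replicate]
    omega
  subst hlen
  refine ⟨Matrix.diagonal l.get, fun j h1 h2 => ?_⟩
  rw [Matrix.diagonal_pow, Matrix.trace_diagonal, ← List.sum_ofFn]
  have : (List.ofFn (l.get ^ j)) = l.map fun y => y ^ j := by
    conv_rhs => rw [← List.ofFn_get l]
    rw [List.map_ofFn]
    rfl
  rw [this, ← Multiset.sum_coe, ← Multiset.map_coe, hl, Multiset.coe_toList, Multiset.map_add,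
    Multiset.sum_add, hx j h1 h2]
  simp [Multiset.map_replicate, zero_pow (show j ≠ 0 by omega)]

/-- The Casimir elements satisfy no universal relation. -/
theorem eq_zero_of_casimirEval_mem {u : ℕ} {P : MvPolynomial ℕ ℂ}
    (hP : IsWeightedHomogeneous (fun j : ℕ => j) P u)
    (h : ∀ N, u ≤ N → casimirEval N P ∈ wordsLT N u) : P = 0 := by
  obtain ⟨n, hn⟩ := exists_matrix_power_traces u
  let S : ℕ → Set ℂ := fun j => if j = 0 then (fun N : ℕ => (N : ℂ)) '' Set.Ici (max u n)
    else Set.univ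
  have hS : ∀ j, (S j).Infinite := by
    intro j
    by_cases hj : j = 0
    · simp only [S, hj, if_true]
      exact (Set.Ici_infinite _).image Nat.cast_injective.injOn
    · simp only [S, hj, if_false]
      exact Set.infinite_univ
  -- `c_0` runs through the large integers, the other variables through all complex numbers
  refine funext_set S hS fun x hx => ?_
  obtain ⟨N, hN, hxN⟩ : x 0 ∈ (fun N : ℕ => (N : ℂ)) '' Set.Ici (max u n) := by
    simpa [S] using hx 0 (Set.mem_univ _)
  have hN' := max_le_iff.1 (Set.mem_Ici.1 hN)
  obtain ⟨Y, hY⟩ := hn N hN'.2 x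
  have h1 := (casimirEval_symb (N := N) hP).2 Y
  rw [symb_eq_zero_of_mem Y (h N hN'.1)] at h1
  rw [map_zero, h1]
  refine eval₂Hom_congr' rfl (fun j hj _ => ?_) rfl
  rcases Nat.eq_zero_or_pos j with rfl | hj0
  · simp [← hxN]
  · refine (hY j hj0 ?_).symm
    obtain ⟨d, hd, hjd⟩ := (mem_vars_iff_mem_support _).1 hj
    have hw := hP (mem_support_iff.1 hd)
    rw [← hw, Finsupp.weight_apply, Finsupp.sum]
    have h2 : j ≤ d j • j := by
      have : d j ≠ 0 := Finsupp.mem_support_iff.1 hjd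
      rw [smul_eq_mul]
      exact Nat.le_mul_of_pos_left _ (Nat.pos_of_ne_zero this)
    exact h2.trans (Finset.single_le_sum (f := fun j => d j • j) (fun _ _ => Nat.zero_le _) hjd)

namespace Diagram

variable {Γ : Diagram}

theorem isHighestWeightPart_statePoly : Γ.IsHighestWeightPart (statePoly Γ) := by
  refine ⟨statePoly_isWeightedHomogeneous, fun N _ => ?_⟩
  have h1 := glWeight_symb (Γ := Γ) N
  have h2 := casimirEval_symb (N := N) (statePoly_isWeightedHomogeneous (Γ := Γ))
  refine mem_wordsLT_of_symb_eq_zero (sub_mem h1.1 h2.1) fun Y => ?_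
  rw [map_sub, h1.2, h2.2, sub_self]

theorem IsHighestWeightPart.unique {P Q : MvPolynomial ℕ ℂ} (hP : Γ.IsHighestWeightPart P)
    (hQ : Γ.IsHighestWeightPart Q) : P = Q := by
  refine sub_eq_zero.1 (eq_zero_of_casimirEval_mem
    ((weightedHomogeneousSubmodule ℂ (fun j : ℕ => j) Γ.legs).sub_mem hP.1 hQ.1) fun N hN => ?_)
  have h := sub_mem (hQ.2 N hN) (hP.2 N hN)
  have e : casimirEval N (P - Q) = casimirEval N P - casimirEval N Q := by simp [casimirEval]
  rw [e]
  convert h using 1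
  abel

theorem existsUnique_isHighestWeightPart : ∃! P, Γ.IsHighestWeightPart P :=
  ⟨statePoly Γ, isHighestWeightPart_statePoly, fun _ h => h.unique isHighestWeightPart_statePoly⟩

theorem highestWeightPart_eq : Γ.highestWeightPart = statePoly Γ :=
  (Classical.epsilon_spec (p := Γ.IsHighestWeightPart)
    ⟨_, isHighestWeightPart_statePoly⟩).unique isHighestWeightPart_statePoly

end Diagram

/-! ### The leading polynomials and their linear independence -/

namespace Arch

/-- The weight function counting, with multiplicity, the entries of a multiset that are smaller
than `c`. -/
noncomputable def countLT (c : ℕ) : (ℕ →₀ ℕ) →+ ℕ :=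
  Finsupp.weight fun j => if j < c then 1 else 0

theorem countLT_single (c j m : ℕ) :
    countLT c (Finsupp.single j m) = if j < c then m else 0 := by
  simp [countLT, Finsupp.weight_apply]

variable {k : ℕ}

/-- The exponent of the monomial `c_{a_1} ⋯ c_{a_k} c_b ^ 2`. -/
noncomputable def targetExp (a : Fin k → ℕ) (b : ℕ) : ℕ →₀ ℕ :=
  ∑ i, Finsupp.single (a i) 1 + Finsupp.single b 2

variable {L : Type} [Fintype L]

/-- The number of legs on block `i` that point inwards. -/
def inner (β : L → Fin (k + 1)) (t : L → Bool) (i : Fin (k + 1)) : ℕ :=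
  (Finset.univ.filter fun l => β l = i ∧ t l = false).card

/-- The number of legs that point outwards. -/
def outer (t : L → Bool) : ℕ := (Finset.univ.filter fun l => t l = true).card

/-- The exponent of the monomial of a distribution of the legs: a factor for the outer face and a
factor for each of the other faces. -/
noncomputable def faceExp (β : L → Fin (k + 1)) (t : L → Bool) : ℕ →₀ ℕ :=
  Finsupp.single (outer t) 1 + ∑ i, Finsupp.single (inner β t i) 1

/-- A planar surface has an outer face and `k + 1` inner faces, numbered by `Fin (k + 1)`, and the
leg `l` lies between the outer face and the face `β l`. The polynomial is the sum over all
distributions of the legs to the adjacent faces, with a sign for each leg that points inwards. -/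
noncomputable def archPoly [DecidableEq L] (β : L → Fin (k + 1)) : MvPolynomial ℕ ℂ :=
  ∑ t : L → Bool, (∏ l, boolSign (t l)) • monomial (faceExp β t) 1

theorem coeff_archPoly [DecidableEq L] (β : L → Fin (k + 1)) (d : ℕ →₀ ℕ) :
    coeff d (archPoly β) = ∑ t : L → Bool, if faceExp β t = d then ∏ l, boolSign (t l) else 0 := by
  classical
  simp [archPoly, coeff_sum, coeff_monomial]

theorem degree_faceExp (β : L → Fin (k + 1)) (t : L → Bool) : (faceExp β t).degree = k + 2 := by
  simp only [faceExp, map_add, map_sum, Finsupp.degree_single, Finset.sum_const, Finset.card_univ,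
    Fintype.card_fin, smul_eq_mul]
  ring

theorem monomial_faceExp (β : L → Fin (k + 1)) (t : L → Bool) :
    (monomial (faceExp β t) 1 : MvPolynomial ℕ ℂ) = X (outer t) * ∏ i, X (inner β t i) := by
  have h := fun f : Fin (k + 1) → ℕ →₀ ℕ => monomial_sum_one (R := ℂ) Finset.univ f
  have h2 := monomial_mul (R := ℂ) (s := Finsupp.single (outer t) 1)
    (s' := ∑ i, Finsupp.single (inner β t i) 1) (a := 1) (b := 1)
  rw [one_mul] at h2
  rw [faceExp, ← h2, h]
  rfl

theorem archPoly_isHomogeneous [DecidableEq L] (β : L → Fin (k + 1)) :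
    (archPoly β).IsHomogeneous (k + 2) :=
  IsHomogeneous.sum _ _ _ fun t _ => by
    rw [smul_eq_C_mul, ← zero_add (k + 2)]
    exact (isHomogeneous_C _ _).mul (isHomogeneous_monomial _ (degree_faceExp β t))

/-- The blocks have the sizes `a_1, …, a_k, 2 b`. -/
structure HasSizes (β : L → Fin (k + 1)) (a : Fin k → ℕ) (b : ℕ) : Prop where
  arch : ∀ i, (Finset.univ.filter fun l => β l = i.castSucc).card = a i
  deck : (Finset.univ.filter fun l => β l = Fin.last k).card = 2 * b

variable {β : L → Fin (k + 1)} {a : Fin k → ℕ} {b : ℕ}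

theorem HasSizes.inner_le (h : HasSizes β a b) (t : L → Bool) (i : Fin k) :
    inner β t i.castSucc ≤ a i := by
  rw [← h.arch i]
  exact Finset.card_le_card (Finset.monotone_filter_right _ fun l _ hl => hl.1)

theorem countLT_faceExp (c : ℕ) (t : L → Bool) :
    (Finset.univ.filter fun i : Fin k => inner β t i.castSucc < c).card ≤
      countLT c (faceExp β t) := by
  rw [faceExp, map_add, map_sum, Fin.sum_univ_castSucc, Finset.card_filter]
  simp only [countLT_single]
  omega

theorem countLT_targetExp {c : ℕ} (hc : c ≤ b) :
    countLT c (targetExp a b) = (Finset.univ.filter fun i : Fin k => a i < c).card := by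
  rw [targetExp, map_add, map_sum, Finset.card_filter]
  simp only [countLT_single, if_neg hc.not_gt, add_zero]

/-- Triangularity: at least `i` entries of the exponent of a distribution are at most `a_i`, and
this bounds the `i`-th entry of an equal exponent. -/
theorem HasSizes.le_of_faceExp_eq (h : HasSizes β a b) (ha : Monotone a) {a' : Fin k → ℕ} {b' : ℕ}
    (ha' : Monotone a') (hb' : ∀ i, a' i ≤ b') {t : L → Bool} (ht : faceExp β t = targetExp a' b')
    (i : Fin k) : a' i ≤ a i := by
  by_contra! hi
  have h1 := countLT_faceExp (β := β) (a i + 1) t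
  rw [ht, countLT_targetExp (c := a i + 1) (hi.trans_le (hb' i))] at h1
  have h2 : Finset.Iic i ⊆ Finset.univ.filter fun j : Fin k => inner β t j.castSucc < a i + 1 := by
    intro j hj
    have := (h.inner_le t j).trans (ha (Finset.mem_Iic.1 hj))
    simpa [Nat.lt_succ_iff] using this
  have h3 : (Finset.univ.filter fun j : Fin k => a' j < a i + 1) ⊆ Finset.Iio i := by
    intro j hj
    rw [Finset.mem_filter] at hj
    rw [Finset.mem_Iio]
    by_contra! hij
    have := ha' hij
    omega
  have h4 := Finset.card_le_card h2
  have h5 := Finset.card_le_card h3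
  rw [Fin.card_Iic] at h4
  rw [Fin.card_Iio] at h5
  omega

/-- The distributions contributing to the diagonal coefficient have all legs of the arches and
half of the legs of the deck pointing inwards. -/
theorem HasSizes.inner_eq_of_faceExp_eq (h : HasSizes β a b) (hb : ∀ i, a i ≤ b) {t : L → Bool}
    (ht : faceExp β t = targetExp a b) :
    (∀ i : Fin k, inner β t i.castSucc = a i) ∧ inner β t (Fin.last k) = b := by
  have h0 : ∀ i : Fin k, inner β t i.castSucc = a i := by
    intro i
    refine le_antisymm (h.inner_le t i) ?_
    by_contra! hi
    have h1 := countLT_faceExp (β := β) (a i) t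
    rw [ht, countLT_targetExp (hb i)] at h1
    refine absurd h1 (not_le.2 (Finset.card_lt_card ?_))
    refine (Finset.ssubset_iff_of_subset fun j hj => ?_).2 ⟨i, by simpa using hi, by simp⟩
    simp only [Finset.mem_filter, Finset.mem_univ, true_and] at hj ⊢
    exact (h.inner_le t j).trans_lt hj
  refine ⟨h0, ?_⟩
  have h1 := DFunLike.congr_fun ht (inner β t (Fin.last k))
  simp only [faceExp, targetExp, Fin.sum_univ_castSucc, h0, Finsupp.add_apply,
    Finsupp.single_eq_same] at h1
  by_contra hne
  rw [Finsupp.single_eq_of_ne (a := b) hne] at h1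
  omega

theorem prod_boolSign (β : L → Fin (k + 1)) (t : L → Bool) :
    ∏ l, boolSign (t l) = (-1) ^ ∑ i, inner β t i := by
  have h1 : ∑ i, inner β t i = (Finset.univ.filter fun l => t l = false).card := by
    rw [Finset.card_eq_sum_card_fiberwise (f := β) (t := Finset.univ) fun _ _ => Finset.mem_univ _]
    refine Finset.sum_congr rfl fun i _ => ?_
    rw [inner, Finset.filter_filter]
    simp only [and_comm]
  rw [h1, ← Finset.prod_const, Finset.prod_filter]
  refine Finset.prod_congr rfl fun l _ => ?_
  cases t l <;> simp [boolSign]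

theorem HasSizes.exists_faceExp_eq [DecidableEq L] (h : HasSizes β a b) :
    ∃ t : L → Bool, faceExp β t = targetExp a b := by
  obtain ⟨S, hS, hcard⟩ := Finset.exists_subset_card_eq
    (s := Finset.univ.filter fun l => β l = Fin.last k) (n := b) (by rw [h.deck]; omega)
  have hS' : ∀ l ∈ S, β l = Fin.last k := fun l hl => by simpa using hS hl
  refine ⟨fun l => decide (l ∈ S), ?_⟩
  have h1 : outer (fun l => decide (l ∈ S)) = b := by
    rw [outer, ← hcard]; congr 1; ext l; simp
  have h2 : inner β (fun l => decide (l ∈ S)) (Fin.last k) = b := by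
    have : (Finset.univ.filter fun l => β l = Fin.last k ∧ decide (l ∈ S) = false) =
        (Finset.univ.filter fun l => β l = Fin.last k) \ S := by ext l; simp
    rw [inner, this, Finset.card_sdiff_of_subset hS, h.deck, hcard]
    omega
  have h3 : ∀ i : Fin k, inner β (fun l => decide (l ∈ S)) i.castSucc = a i := by
    intro i
    rw [inner, ← h.arch i]
    congr 1
    ext l
    simp only [Finset.mem_filter, Finset.mem_univ, true_and, decide_eq_false_iff_not,
      and_iff_left_iff_imp]
    intro hl hlS
    exact absurd ((hS' l hlS).symm.trans hl) (Fin.castSucc_lt_last i).ne'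
  rw [faceExp, targetExp, Fin.sum_univ_castSucc, h1, h2]
  simp only [h3]
  rw [add_left_comm, ← Finsupp.single_add]

theorem HasSizes.coeff_ne_zero [DecidableEq L] (h : HasSizes β a b) (hb : ∀ i, a i ≤ b) :
    coeff (targetExp a b) (archPoly β) ≠ 0 := by
  have h1 : ∀ t : L → Bool, (if faceExp β t = targetExp a b then ∏ l, boolSign (t l) else 0) =
      if faceExp β t = targetExp a b then (-1 : ℂ) ^ (∑ i, a i + b) else 0 := by
    intro t
    split_ifs with ht
    · obtain ⟨h2, h3⟩ := h.inner_eq_of_faceExp_eq hb ht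
      rw [prod_boolSign β, Fin.sum_univ_castSucc, h3]
      simp only [h2]
    · rfl
  rw [coeff_archPoly, Finset.sum_congr rfl fun t _ => h1 t, ← Finset.sum_filter,
    Finset.sum_const, nsmul_eq_mul]
  refine mul_ne_zero (Nat.cast_ne_zero.2 (Finset.card_ne_zero.2 ?_))
    (pow_ne_zero _ (neg_ne_zero.2 one_ne_zero))
  obtain ⟨t, ht⟩ := h.exists_faceExp_eq
  exact ⟨t, by simpa using ht⟩

theorem HasSizes.le_of_coeff_ne_zero [DecidableEq L] (h : HasSizes β a b) (ha : Monotone a)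
    {a' : Fin k → ℕ} {b' : ℕ} (ha' : Monotone a') (hb' : ∀ i, a' i ≤ b')
    (hne : coeff (targetExp a' b') (archPoly β) ≠ 0) (i : Fin k) : a' i ≤ a i := by
  rw [coeff_archPoly] at hne
  obtain ⟨t, _, ht⟩ := Finset.exists_ne_zero_of_sum_ne_zero hne
  exact h.le_of_faceExp_eq ha ha' hb' (of_not_not fun hc => ht (if_neg hc)) i

/-- Linear independence by triangularity of the coefficients at the monomials
`c_{a_1} ⋯ c_{a_k} c_b ^ 2`. -/
theorem linearIndependent_of_coeff {u : ℕ} (F : pontNeufIndex k u → MvPolynomial ℕ ℂ)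
    (h1 : ∀ p q : pontNeufIndex k u, coeff (targetExp q.1.1 q.1.2) (F p) ≠ 0 →
      ∀ i, q.1.1 i ≤ p.1.1 i)
    (h2 : ∀ p : pontNeufIndex k u, coeff (targetExp p.1.1 p.1.2) (F p) ≠ 0) :
    LinearIndependent ℂ F := by
  classical
  rw [linearIndependent_iff']
  intro s g hg
  by_contra! hne
  obtain ⟨p₀, hp₀, hgp₀⟩ := hne
  obtain ⟨p, hp, hmax⟩ := (s.filter fun p => g p ≠ 0).exists_max_image (fun p => ∑ i, p.1.1 i)
    ⟨p₀, Finset.mem_filter.2 ⟨hp₀, hgp₀⟩⟩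
  rw [Finset.mem_filter] at hp
  have h3 := congrArg (coeff (targetExp p.1.1 p.1.2)) hg
  rw [coeff_sum, coeff_zero, Finset.sum_eq_single p] at h3
  · rw [coeff_smul, smul_eq_mul] at h3
    exact (mul_ne_zero hp.2 (h2 p)) h3
  · intro q hq hqp
    rw [coeff_smul, smul_eq_mul]
    by_contra hc
    have hle := h1 q p (right_ne_zero_of_mul hc)
    have hge := hmax q (Finset.mem_filter.2 ⟨hq, left_ne_zero_of_mul hc⟩)
    have hsum : ∑ i, p.1.1 i = ∑ i, q.1.1 i :=
      le_antisymm (Finset.sum_le_sum fun i _ => hle i) hge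
    have heq : p.1.1 = q.1.1 := funext fun i =>
      (Finset.sum_eq_sum_iff_of_le fun i _ => hle i).1 hsum i (Finset.mem_univ i)
    have hpu := p.2.2.2
    have hqu := q.2.2.2
    exact hqp (Subtype.ext (Prod.ext heq.symm (by omega)))
  · exact fun h => absurd hp.1 h

end Arch

/-! ### States with the maximal number of boundary components -/

namespace Diagram

variable {Γ : Diagram}

theorem card_cycles_eq {F : Type*} [Fintype F] {s : Γ.V → Bool} {f : Γ.HalfEdge → F}
    (hf : ∀ h, f (Γ.opp h) = f (turn s h)) (hsurj : Function.Surjective f)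
    (hcard : Fintype.card (Cycles (walk s)) ≤ Fintype.card F) :
    ∃ g : Cycles (walk s) ≃ F, ∀ h, g (face s h) = f h := by
  obtain ⟨g, hg⟩ := exists_factor_face hf
  have h1 : Function.Surjective g := fun y => by
    obtain ⟨h, rfl⟩ := hsurj y
    exact ⟨_, hg h⟩
  exact ⟨Equiv.ofBijective g ((Fintype.bijective_iff_surjective_and_card g).2
    ⟨h1, le_antisymm hcard (Fintype.card_le_of_surjective g h1)⟩), hg⟩

/-- If the boundary components are identified with an outer face and `k + 1` inner faces, and each
leg `l` lies on the outer face or on the face `β l` according to `t l`, then the monomial of the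
state is the one attached to the distribution `t`. -/
theorem stateMonomial_eq {k : ℕ} {s : Γ.V → Bool} {f : Γ.HalfEdge → Option (Fin (k + 1))}
    (hf : ∀ h, f (Γ.opp h) = f (turn s h)) (hsurj : Function.Surjective f)
    (hcard : Fintype.card (Cycles (walk s)) ≤ k + 2) {β : Γ.L → Fin (k + 1)} {t : Γ.L → Bool}
    (hleg : ∀ l, f (Sum.inr l) = if t l then none else some (β l)) :
    stateMonomial s = monomial (Arch.faceExp β t) 1 ∧
      Fintype.card (Cycles (walk s)) = k + 2 := by
  obtain ⟨g, hg⟩ := card_cycles_eq hf hsurj (by simpa using hcard)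
  refine ⟨?_, by rw [Fintype.card_congr g]; simp⟩
  have h1 : ∀ y, legCount s (g.symm y) =
      (Finset.univ.filter fun l => f (Sum.inr l) = y).card := by
    intro y
    rw [legCount]
    congr 1
    ext l
    rw [Finset.mem_filter, Finset.mem_filter, ← hg, g.eq_symm_apply]
  rw [stateMonomial, ← g.symm.prod_comp, Fintype.prod_option, Arch.monomial_faceExp]
  simp only [h1, hleg]
  congr 2
  · rw [Arch.outer]
    congr 2
    ext l
    cases t l <;> simp
  · funext i
    rw [Arch.inner]
    congr 2
    ext l
    cases t l <;> simp [and_comm]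

theorem face_tgt (s : Γ.V → Bool) (e : Γ.E) : face s (Γ.tgt e) = face s (turn s (Γ.src e)) := by
  rw [← face_opp, opp_src]

theorem face_src (s : Γ.V → Bool) (e : Γ.E) : face s (Γ.src e) = face s (turn s (Γ.tgt e)) := by
  rw [← face_opp, opp_tgt]

theorem apply_opp_of_edges {F : Type*} {s : Γ.V → Bool} {f : Γ.HalfEdge → F}
    (hs : ∀ e, f (Γ.tgt e) = f (turn s (Γ.src e))) (ht : ∀ e, f (Γ.src e) = f (turn s (Γ.tgt e)))
    (h : Γ.HalfEdge) : f (Γ.opp h) = f (turn s h) :=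
  halfEdge_cases (p := fun h => f (Γ.opp h) = f (turn s h)) (fun e => by rw [opp_src, hs])
    (fun e => by rw [opp_tgt, ht]) h

theorem stateMonomial_isHomogeneous (s : Γ.V → Bool) :
    (stateMonomial s).IsHomogeneous (Fintype.card (Cycles (walk s))) := by
  have := IsHomogeneous.prod (R := ℂ) Finset.univ (fun q => X (legCount s q)) (fun _ => 1)
    fun q _ => isHomogeneous_X ℂ (legCount s q)
  simpa [stateMonomial] using this

theorem homogeneousComponent_statePoly (hΓ : Γ.circles = 0) (d : ℕ) :
    homogeneousComponent d (statePoly Γ) =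
      ∑ s : Γ.V → Bool with Fintype.card (Cycles (walk s)) = d,
        stateSign s • stateMonomial s := by
  rw [statePoly, hΓ, mul_zero, pow_zero, one_mul, map_sum, Finset.sum_filter]
  refine Finset.sum_congr rfl fun s _ => ?_
  rw [map_smul, homogeneousComponent_of_mem (stateMonomial_isHomogeneous s)]
  simp only [eq_comm (a := d), smul_ite, smul_zero]

theorem CD_eq (hΓ : Γ.circles = 0) {d : ℕ}
    (hd : ∀ s : Γ.V → Bool, Fintype.card (Cycles (walk s)) ≤ d)
    (hne : homogeneousComponent d (statePoly Γ) ≠ 0) :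
    Γ.CD = homogeneousComponent d (statePoly Γ) := by
  have h1 : (statePoly Γ).totalDegree ≤ d := by
    rw [statePoly, hΓ, mul_zero, pow_zero, one_mul]
    refine totalDegree_finsetSum_le fun s _ => ?_
    exact (totalDegree_smul_le _ _).trans
      ((stateMonomial_isHomogeneous s).totalDegree_le.trans (hd s))
  have h2 : d ≤ (statePoly Γ).totalDegree := by
    by_contra! h
    exact hne (homogeneousComponent_eq_zero _ _ h)
  rw [CD, highestWeightPart_eq, le_antisymm h1 h2]

end Diagram

/-! ### Wheels -/

open Diagram

theorem card_cycles_wheel_le {m : ℕ} (s : (wheel (m + 1)).V → Bool) :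
    Fintype.card (Cycles (walk s)) ≤ 2 := by
  let Λ : Fin (m + 1) → Fin 3 → Cycles (walk s) := fun i k => face s (Sum.inl (i, k))
  have hsrc : ∀ i : Fin (m + 1), Λ (finRotate (m + 1) i) 1 = Λ i (if s i then 1 else 2) :=
    fun i => (face_tgt s (Sum.inl i)).trans (congrArg (face s) (turn_inl s i 0))
  have htgt : ∀ i : Fin (m + 1), Λ i 0 =
      Λ (finRotate (m + 1) i) (if s (finRotate (m + 1) i) then 2 else 0) :=
    fun i => (face_src s (Sum.inl i)).trans (congrArg (face s) (turn_inl s _ 1))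
  have hleg : ∀ i : Fin (m + 1), Λ i 2 = face s (Sum.inr i) :=
    fun i => face_tgt s (Sum.inr i)
  have hleg' : ∀ i : Fin (m + 1), Λ i 2 = Λ i (if s i then 0 else 1) :=
    fun i => (hleg i).trans ((face_src s (Sum.inr i)).trans (congrArg (face s) (turn_inl s i 2)))
  have h1 : ∀ i, Λ (finRotate (m + 1) i) 1 = Λ i 1 := fun i => by
    have e1 := hsrc i
    have e2 := hleg' i
    cases h : s i <;> simp only [h, if_true, Bool.false_eq_true, if_false] at e1 e2
    · rw [e1, e2]
    · exact e1
  have h0 : ∀ i, Λ (finRotate (m + 1) i) 0 = Λ i 0 := fun i => by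
    have e1 := htgt i
    have e2 := hleg' (finRotate (m + 1) i)
    cases h : s (finRotate (m + 1) i) <;>
      simp only [h, if_true, Bool.false_eq_true, if_false] at e1 e2
    · exact e1.symm
    · rw [e1, e2]
  have hall : ∀ i, Λ i 0 = Λ 0 0 ∧ Λ i 1 = Λ 0 1 := by
    intro i
    induction i using Fin.induction with
    | zero => exact ⟨rfl, rfl⟩
    | succ i ih =>
      have e : finRotate (m + 1) i.castSucc = i.succ := by
        rw [finRotate_apply, Fin.coeSucc_eq_succ]
      rw [← e, h0, h1]
      exact ih
  have hall2 : ∀ i, Λ i 2 = Λ 0 0 ∨ Λ i 2 = Λ 0 1 := by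
    intro i
    rw [hleg' i]
    cases s i
    · exact Or.inr (hall i).2
    · exact Or.inl (hall i).1
  have hsurj : Function.Surjective fun b : Bool => if b then Λ 0 0 else Λ 0 1 := by
    intro q
    obtain ⟨h, rfl⟩ := cyc_surjective _ q
    have key : face s h = Λ 0 0 ∨ face s h = Λ 0 1 := by
      rcases h with ⟨i, x⟩ | i
      · fin_cases x
        · exact Or.inl (hall i).1
        · exact Or.inr (hall i).2
        · exact hall2 i
      · have := hall2 i
        rwa [hleg i] at this
    rcases key with h | h
    · exact ⟨true, h.symm⟩
    · exact ⟨false, h.symm⟩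
  simpa using Fintype.card_le_of_surjective _ hsurj

/-- Every state of a wheel is an annulus. -/
theorem stateMonomial_wheel {m : ℕ} (s : (wheel (m + 1)).V → Bool) :
    stateMonomial s = monomial (Arch.faceExp (fun _ : Fin (m + 1) => (0 : Fin 1)) s) 1 ∧
      Fintype.card (Cycles (walk s)) = 2 := by
  let f : (wheel (m + 1)).HalfEdge → Option (Fin 1) := Sum.elim
    (fun x => if x.2 = 0 then none else if x.2 = 1 then some 0 else
      if s x.1 then none else some 0)
    (fun i => if s i then none else some 0)
  refine stateMonomial_eq (k := 0) (f := f) (apply_opp_of_edges ?_ ?_) ?_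
    (card_cycles_wheel_le s) fun l => rfl
  · rintro (i | i)
    · refine Eq.trans ?_ (congrArg f (turn_inl s i 0)).symm
      change some 0 = _
      cases h : s i <;> simp [f, h]
    · rfl
  · rintro (i | i)
    · refine Eq.trans ?_ (congrArg f (turn_inl s (finRotate (m + 1) i) 1)).symm
      change none = _
      generalize finRotate (m + 1) i = j
      cases h : s j <;> simp [f, h]
    · refine Eq.trans ?_ (congrArg f (turn_inl s i 2)).symm
      change (if s i then none else some 0) = _
      cases h : s i <;> simp [f]
  · rintro (_ | i)
    · exact ⟨Sum.inl ((0 : Fin (m + 1)), 0), rfl⟩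
    · exact ⟨Sum.inl ((0 : Fin (m + 1)), 1), by
        rw [show i = 0 from Subsingleton.elim (α := Fin 1) i 0]; rfl⟩

theorem hasSizes_wheel (b : ℕ) (a : Fin 0 → ℕ) :
    Arch.HasSizes (fun _ : Fin (2 * b) => (0 : Fin 1)) a b :=
  ⟨fun i => i.elim0, by simp⟩

theorem CD_wheel (b : ℕ) :
    (wheel (2 * b)).CD = Arch.archPoly (fun _ : Fin (2 * b) => (0 : Fin 1)) := by
  rcases Nat.eq_zero_or_pos b with rfl | hb
  · -- without legs the diagram is a closed circle, which contributes `c_0 ^ 2`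
    rw [Nat.mul_zero]
    have h1 : statePoly (wheel 0) = Arch.archPoly (fun _ : Fin 0 => (0 : Fin 1)) := by
      have hc : (wheel 0).circles = 1 := rfl
      have h2 : ∀ s : (wheel 0).V → Bool, stateSign s • stateMonomial s = 1 := fun s => by
        have : IsEmpty (Cycles (walk s)) := ⟨fun q => by
          obtain ⟨h, rfl⟩ := cyc_surjective _ q
          rcases h with ⟨i, x⟩ | i
          exacts [Fin.elim0 i, Fin.elim0 i]⟩
        rw [stateMonomial, Fintype.prod_empty]
        exact one_smul ℂ _
      have h3 : Fintype.card ((wheel 0).V → Bool) = 1 := Fintype.card_eq_one_iff.2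
        ⟨fun i => Fin.elim0 i, fun s => funext fun i => Fin.elim0 i⟩
      rw [statePoly, hc, Finset.sum_congr rfl fun s _ => h2 s, Finset.sum_const, Finset.card_univ,
        h3]
      simp [Arch.archPoly, Arch.monomial_faceExp, Arch.outer, Arch.inner, sq]
    have hne : Arch.archPoly (fun _ : Fin 0 => (0 : Fin 1)) ≠ 0 := fun h =>
      (hasSizes_wheel 0 Fin.elim0).coeff_ne_zero (fun i => i.elim0) (by
        change coeff _ (Arch.archPoly (fun _ : Fin 0 => (0 : Fin 1))) = 0
        rw [h, coeff_zero])
    have h4 := Arch.archPoly_isHomogeneous (fun _ : Fin 0 => (0 : Fin 1))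
    rw [CD, highestWeightPart_eq, h1, h4.totalDegree hne, homogeneousComponent_of_mem h4,
      if_pos rfl]
  · obtain ⟨m, hm⟩ : ∃ m, 2 * b = m + 1 := ⟨2 * b - 1, by omega⟩
    have hne : Arch.archPoly (fun _ : Fin (2 * b) => (0 : Fin 1)) ≠ 0 := fun h =>
      (hasSizes_wheel b Fin.elim0).coeff_ne_zero (fun i => i.elim0) (by rw [h, coeff_zero])
    rw [hm] at hne ⊢
    have h1 : homogeneousComponent 2 (statePoly (wheel (m + 1))) =
        Arch.archPoly (fun _ : Fin (m + 1) => (0 : Fin 1)) := by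
      rw [homogeneousComponent_statePoly rfl, Finset.filter_true_of_mem
        fun s _ => (stateMonomial_wheel s).2]
      exact Finset.sum_congr rfl fun s _ => by rw [(stateMonomial_wheel s).1]; rfl
    rw [CD_eq rfl card_cycles_wheel_le (by rw [h1]; exact hne), h1]

/-! ### Counting the boundary components of a bridge -/

/-- The relations between the boundary components running along a bridge, in a state with signs
`r i`, `t i` at the two ends of the rung `i` and signs `p`, `q` at the two ends of the deck.
Between consecutive rungs, `A` and `B` run along the two sides of the outer cycle, and `C` and `D`
along the two sides of the path; `S i` and `T i` run along the two sides of the rung `i`, and `A'`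
and `B'` along the two sides of the deck. At a vertex with positive sign the three corners are
filled in planar fashion, at a vertex with negative sign the sides are exchanged. -/
structure Strip (Q : Type*) (n : ℕ) (r t : Fin n → Bool) (p q : Bool) where
  A : Fin (n + 1) → Q
  B : Fin (n + 1) → Q
  C : Fin (n + 1) → Q
  D : Fin (n + 1) → Q
  S : Fin n → Q
  T : Fin n → Q
  A' : Q
  B' : Q
  r_pos : ∀ i, r i = true →
    A i.castSucc = A i.succ ∧ T i = B i.castSucc ∧ S i = B i.succ
  r_neg : ∀ i, r i = false →
    B i.castSucc = B i.succ ∧ S i = A i.castSucc ∧ T i = A i.succ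
  t_pos : ∀ i, t i = true →
    D i.castSucc = D i.succ ∧ T i = C i.castSucc ∧ S i = C i.succ
  t_neg : ∀ i, t i = false →
    C i.castSucc = C i.succ ∧ S i = D i.castSucc ∧ T i = D i.succ
  p_pos : p = true → A 0 = A' ∧ B 0 = C 0 ∧ D 0 = B'
  p_neg : p = false → B 0 = B' ∧ A 0 = D 0 ∧ C 0 = A'
  q_pos : q = true → A (Fin.last n) = A' ∧ B (Fin.last n) = C (Fin.last n) ∧ D (Fin.last n) = B'
  q_neg : q = false → B (Fin.last n) = B' ∧ A (Fin.last n) = D (Fin.last n) ∧ C (Fin.last n) = A'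
  cover : ∀ x, ∃ i, x = A i ∨ x = B i ∨ x = C i ∨ x = D i

namespace Strip

variable {Q : Type*} {n : ℕ} {r t : Fin n → Bool} {p q : Bool}

/-- Exchanging the two sides of all edges reverses all signs. -/
def swap (σ : Strip Q n r t p q) : Strip Q n (fun i => !r i) (fun i => !t i) (!p) (!q) where
  A := σ.B
  B := σ.A
  C := σ.D
  D := σ.C
  S := σ.T
  T := σ.S
  A' := σ.B'
  B' := σ.A'
  r_pos i h := σ.r_neg i (by simpa using h)
  r_neg i h := σ.r_pos i (by simpa using h)
  t_pos i h := σ.t_neg i (by simpa using h)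
  t_neg i h := σ.t_pos i (by simpa using h)
  p_pos h := σ.p_neg (by simpa using h)
  p_neg h := σ.p_pos (by simpa using h)
  q_pos h := σ.q_neg (by simpa using h)
  q_neg h := σ.q_pos (by simpa using h)
  cover x := by
    obtain ⟨i, h | h | h | h⟩ := σ.cover x
    exacts [⟨i, by simp [h]⟩, ⟨i, by simp [h]⟩, ⟨i, by simp [h]⟩, ⟨i, by simp [h]⟩]

/-- Boundary components that suffice to meet all of them when `p` is positive: three of them start
at `p`, and at most one more starts at each rung. -/
def coord (σ : Strip Q n r t p q) : Fin (n + 1) ⊕ Bool → Q :=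
  Sum.elim (Fin.cases (σ.B 0) fun i => if r i then σ.B i.succ else σ.A i.succ)
    fun b => if b then σ.A 0 else σ.D 0

theorem mem_range_coord (σ : Strip Q n r t true q) (i : Fin (n + 1)) :
    σ.A i ∈ Set.range σ.coord ∧ σ.B i ∈ Set.range σ.coord ∧ σ.C i ∈ Set.range σ.coord ∧
      σ.D i ∈ Set.range σ.coord := by
  induction i using Fin.induction with
  | zero =>
    have hB : σ.B 0 ∈ Set.range σ.coord := ⟨Sum.inl 0, rfl⟩
    obtain ⟨-, h2, -⟩ := σ.p_pos rfl
    exact ⟨⟨Sum.inr true, rfl⟩, hB, h2 ▸ hB, ⟨Sum.inr false, rfl⟩⟩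
  | succ i ih =>
    obtain ⟨hA, hB, hC, hD⟩ := ih
    have hx : (if r i then σ.B i.succ else σ.A i.succ) ∈ Set.range σ.coord :=
      ⟨Sum.inl i.succ, rfl⟩
    cases hr : r i
    · obtain ⟨r1, r2, r3⟩ := σ.r_neg i hr
      simp only [hr, Bool.false_eq_true, if_false] at hx
      cases ht : t i
      · obtain ⟨t1, t2, t3⟩ := σ.t_neg i ht
        exact ⟨hx, r1 ▸ hB, t1 ▸ hC, (t3.symm.trans r3).symm ▸ hx⟩
      · obtain ⟨t1, t2, t3⟩ := σ.t_pos i ht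
        exact ⟨hx, r1 ▸ hB, (r2.symm.trans t3) ▸ hA, t1 ▸ hD⟩
    · obtain ⟨r1, r2, r3⟩ := σ.r_pos i hr
      simp only [hr, if_true] at hx
      cases ht : t i
      · obtain ⟨t1, t2, t3⟩ := σ.t_neg i ht
        exact ⟨r1 ▸ hA, hx, t1 ▸ hC, (r2.symm.trans t3) ▸ hB⟩
      · obtain ⟨t1, t2, t3⟩ := σ.t_pos i ht
        exact ⟨r1 ▸ hA, hx, (t3.symm.trans r3).symm ▸ hx, t1 ▸ hD⟩

theorem coord_surjective (σ : Strip Q n r t true q) : Function.Surjective σ.coord := by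
  intro x
  obtain ⟨i, rfl | rfl | rfl | rfl⟩ := σ.cover x
  exacts [(σ.mem_range_coord i).1, (σ.mem_range_coord i).2.1, (σ.mem_range_coord i).2.2.1,
    (σ.mem_range_coord i).2.2.2]

/-- If all the components met by `coord` are different, then no sign may differ from that of `p`:
any other sign identifies two of them. -/
theorem signs_of_injective (σ : Strip Q n r t true q) (h : Function.Injective σ.coord) :
    (∀ i, r i = true ∧ t i = true) ∧ q = true := by
  have hAD : σ.A 0 ≠ σ.D 0 := fun e => by
    have := h (a₁ := Sum.inr true) (a₂ := Sum.inr false) e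
    simp at this
  have hBA : ∀ i, σ.coord (Sum.inl i) ≠ σ.A 0 := fun i e => by
    have := h (a₂ := Sum.inr true) e
    simp at this
  have hBD : ∀ i, σ.coord (Sum.inl i) ≠ σ.D 0 := fun i e => by
    have := h (a₂ := Sum.inr false) e
    simp at this
  have hinl : ∀ i j, σ.coord (Sum.inl i) = σ.coord (Sum.inl j) → i = j := fun i j e =>
    Sum.inl_injective (h e)
  have key : ∀ i : Fin (n + 1), (∀ j : Fin n, j.castSucc < i → r j = true ∧ t j = true) ∧
      σ.A i = σ.A 0 ∧ σ.B i = σ.coord (Sum.inl i) ∧ σ.C i = σ.B i ∧ σ.D i = σ.D 0 := by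
    intro i
    induction i using Fin.induction with
    | zero =>
      obtain ⟨-, h2, -⟩ := σ.p_pos rfl
      exact ⟨fun j hj => absurd hj (Fin.not_lt_zero _), rfl, rfl, h2.symm, rfl⟩
    | succ i ih =>
      obtain ⟨hs, hA, hB, hC, hD⟩ := ih
      have hx : σ.coord (Sum.inl i.succ) = if r i then σ.B i.succ else σ.A i.succ := rfl
      have hrt : r i = true ∧ t i = true := by
        cases hr : r i
        · obtain ⟨r1, r2, r3⟩ := σ.r_neg i hr
          simp only [hr, Bool.false_eq_true, if_false] at hx
          cases ht : t i
          · obtain ⟨t1, t2, t3⟩ := σ.t_neg i ht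
            exact absurd (hA.symm.trans (r2.symm.trans (t2.trans hD))) hAD
          · obtain ⟨t1, t2, t3⟩ := σ.t_pos i ht
            have e := hinl _ _ (hx.trans (r3.symm.trans (t2.trans (hC.trans hB))))
            exact absurd e (Fin.castSucc_lt_succ (i := i)).ne'
        · obtain ⟨r1, r2, r3⟩ := σ.r_pos i hr
          simp only [hr, if_true] at hx
          cases ht : t i
          · obtain ⟨t1, t2, t3⟩ := σ.t_neg i ht
            exact absurd (hx.trans (r3.symm.trans (t2.trans hD))) (hBD _)
          · exact ⟨rfl, rfl⟩
      obtain ⟨r1, r2, r3⟩ := σ.r_pos i hrt.1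
      obtain ⟨t1, t2, t3⟩ := σ.t_pos i hrt.2
      simp only [hrt.1, if_true] at hx
      refine ⟨fun j hj => ?_, r1 ▸ hA, hx.symm, t3.symm.trans r3, t1 ▸ hD⟩
      rcases (Fin.le_castSucc_iff.2 hj).lt_or_eq with h' | h'
      · exact hs j h'
      · rw [Fin.castSucc_injective _ h']
        exact hrt
  refine ⟨fun i => (key (Fin.last n)).1 i (Fin.castSucc_lt_last i), ?_⟩
  obtain ⟨-, -, hB, hC, -⟩ := key (Fin.last n)
  cases hq : q
  · exact absurd (hB.symm.trans (hC.symm.trans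
      ((σ.q_neg hq).2.2.trans (σ.p_pos rfl).1.symm))) (hBA _)
  · rfl

theorem card_coord : Fintype.card (Fin (n + 1) ⊕ Bool) = n + 3 := by simp

/-- The boundary has at most `n + 3` components, with equality only if all signs agree. -/
theorem card_le [Fintype Q] (σ : Strip Q n r t p q) : Fintype.card Q ≤ n + 3 ∧
    (Fintype.card Q = n + 3 → (∀ i, r i = p ∧ t i = p) ∧ q = p) := by
  cases p with
  | true =>
    rw [← card_coord]
    exact ⟨Fintype.card_le_of_surjective _ σ.coord_surjective, fun h => σ.signs_of_injective
      ((Fintype.bijective_iff_surjective_and_card _).2 ⟨σ.coord_surjective, h.symm⟩).1⟩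
  | false =>
    have τ : Strip Q n (fun i => !r i) (fun i => !t i) true (!q) := σ.swap
    rw [← card_coord]
    refine ⟨Fintype.card_le_of_surjective _ τ.coord_surjective, fun h => ?_⟩
    have := τ.signs_of_injective
      ((Fintype.bijective_iff_surjective_and_card _).2 ⟨τ.coord_surjective, h.symm⟩).1
    simpa using this

end Strip

/-! ### The boundary components of a bridge -/

namespace PontNeuf

variable {n : ℕ} {m : Fin (n + 2) → ℕ}

theorem next_junction {r : ℕ} [NeZero r] (m : Fin r → ℕ) (i : Fin r) :
    next m (junction m i) = ⟨i + 1, 0⟩ := by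
  simp only [next, junction, Fin.lastCases_last]
  rfl

theorem next_castSucc {r : ℕ} [NeZero r] (m : Fin r → ℕ) (i : Fin r) (j : Fin (m i)) :
    next m ⟨i, j.castSucc⟩ = ⟨i, j.succ⟩ := by
  simp [next]

theorem back_junction {r : ℕ} (m : Fin r → ℕ) (i : Fin r) : back m (junction m i) = 2 := by
  simp [back, junction]

theorem side_junction {r : ℕ} (m : Fin r → ℕ) (i : Fin r) : side m (junction m i) = 1 := by
  simp [side, junction]

theorem back_castSucc {r : ℕ} (m : Fin r → ℕ) (i : Fin r) (j : Fin (m i)) :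
    back m ⟨i, j.castSucc⟩ = 1 := by
  simp [back, (Fin.castSucc_lt_last j).ne]

theorem side_castSucc {r : ℕ} (m : Fin r → ℕ) (i : Fin r) (j : Fin (m i)) :
    side m ⟨i, j.castSucc⟩ = 2 := by
  simp [side, (Fin.castSucc_lt_last j).ne]

theorem castSucc_add_one (i : Fin (n + 1)) : (i.castSucc + 1 : Fin (n + 2)) = i.succ :=
  Fin.coeSucc_eq_succ

/-- The rotation of the three half-edges at a vertex with a given sign. -/
def rot (b : Bool) (k : Fin 3) : Fin 3 := if b then k + 1 else k - 1

section Labels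

variable (s : (bridge n m).V → Bool)

/-- The boundary component through the `k`-th half-edge at a vertex. -/
noncomputable def lab (v : Outer m ⊕ Fin n) (k : Fin 3) : Cycles (walk s) :=
  face s (Sum.inl (v, k))

theorem lab_next (c : Outer m) : lab s (Sum.inl (next m c)) (back m (next m c)) =
    lab s (Sum.inl c) (rot (s (Sum.inl c)) 0) :=
  (face_tgt s (Sum.inl c)).trans (congrArg (face s) (turn_inl s (Sum.inl c) 0))

theorem lab_zero (c : Outer m) : lab s (Sum.inl c) 0 =
    lab s (Sum.inl (next m c)) (rot (s (Sum.inl (next m c))) (back m (next m c))) :=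
  (face_src s (Sum.inl c)).trans (congrArg (face s) (turn_inl s (Sum.inl (next m c)) _))

theorem lab_leg (l : (i : Fin (n + 2)) × Fin (m i)) :
    lab s (Sum.inl ⟨l.1, l.2.castSucc⟩) 2 = face s (Sum.inr l) := by
  have h := face_tgt s (Sum.inr (Sum.inr (Sum.inr l)))
  have h' : lab s (Sum.inl ⟨l.1, l.2.castSucc⟩) (side m ⟨l.1, l.2.castSucc⟩) =
    face s (Sum.inr l) := h
  rwa [side_castSucc] at h'

theorem lab_leg_turn (l : (i : Fin (n + 2)) × Fin (m i)) :
    lab s (Sum.inl ⟨l.1, l.2.castSucc⟩) 2 =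
      lab s (Sum.inl ⟨l.1, l.2.castSucc⟩) (rot (s (Sum.inl ⟨l.1, l.2.castSucc⟩)) 2) := by
  have h : face s (Sum.inr l) = lab s (Sum.inl ⟨l.1, l.2.castSucc⟩)
      (rot (s (Sum.inl ⟨l.1, l.2.castSucc⟩)) (side m ⟨l.1, l.2.castSucc⟩)) :=
    (face_src s (Sum.inr (Sum.inr (Sum.inr l)))).trans
      (congrArg (face s) (turn_inl s (Sum.inl ⟨l.1, l.2.castSucc⟩) _))
  rw [side_castSucc] at h
  rw [← h, lab_leg]

/-- The component along the outer side of block `i`. -/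
noncomputable def outerSide (i : Fin (n + 2)) : Cycles (walk s) :=
  lab s (Sum.inl (junction m i)) (rot (s (Sum.inl (junction m i))) 2)

/-- The component along the inner side of block `i`. -/
noncomputable def innerSide (i : Fin (n + 2)) : Cycles (walk s) :=
  lab s (Sum.inl (junction m i)) 2

/-- Legs do not interrupt the two components along a block. -/
theorem lab_back (i : Fin (n + 2)) (j : Fin (m i + 1)) :
    lab s (Sum.inl ⟨i, j⟩) (back m ⟨i, j⟩) = innerSide s i ∧
      lab s (Sum.inl ⟨i, j⟩) (rot (s (Sum.inl ⟨i, j⟩)) (back m ⟨i, j⟩)) = outerSide s i := by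
  induction j using Fin.reverseInduction with
  | last =>
    have := back_junction m i
    unfold junction at this
    rw [this]
    exact ⟨rfl, rfl⟩
  | cast j ih =>
    have h1 := lab_next s ⟨i, j.castSucc⟩
    have h2 := lab_zero s ⟨i, j.castSucc⟩
    have h3 := lab_leg_turn s ⟨i, j⟩
    rw [next_castSucc] at h1 h2
    rw [ih.1] at h1
    rw [ih.2] at h2
    rw [back_castSucc]
    cases h : s (Sum.inl ⟨i, j.castSucc⟩) <;> simp only [h] at h1 h3 ⊢
    · exact ⟨h3.symm.trans h1.symm, h2⟩
    · exact ⟨h1.symm, h3.trans h2⟩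

theorem innerSide_add_one (i : Fin (n + 2)) : innerSide s (i + 1) =
    lab s (Sum.inl (junction m i)) (rot (s (Sum.inl (junction m i))) 0) := by
  rw [← (lab_back s (i + 1) 0).1, ← lab_next, next_junction]

theorem outerSide_add_one (i : Fin (n + 2)) :
    outerSide s (i + 1) = lab s (Sum.inl (junction m i)) 0 := by
  rw [← (lab_back s (i + 1) 0).2, lab_zero, next_junction]

/-- The component through the inner half-edge at a junction. -/
noncomputable def sideS (i : Fin (n + 2)) : Cycles (walk s) := lab s (Sum.inl (junction m i)) 1

/-- The component on the other side of the inner edge at a junction. -/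
noncomputable def sideT (i : Fin (n + 2)) : Cycles (walk s) :=
  lab s (Sum.inl (junction m i)) (rot (s (Sum.inl (junction m i))) 1)

theorem junction_pos {i : Fin (n + 2)} (h : s (Sum.inl (junction m i)) = true) :
    outerSide s i = outerSide s (i + 1) ∧ sideT s i = innerSide s i ∧
      sideS s i = innerSide s (i + 1) := by
  rw [outerSide_add_one, innerSide_add_one, outerSide, innerSide, sideT, sideS, h]
  exact ⟨rfl, rfl, rfl⟩

theorem junction_neg {i : Fin (n + 2)} (h : s (Sum.inl (junction m i)) = false) :
    innerSide s i = innerSide s (i + 1) ∧ sideS s i = outerSide s i ∧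
      sideT s i = outerSide s (i + 1) := by
  rw [outerSide_add_one, innerSide_add_one, outerSide, innerSide, sideT, sideS, h]
  exact ⟨rfl, rfl, rfl⟩

/-- The component through the first half of an edge of the path. -/
noncomputable def pathC (e : Fin (n + 1)) : Cycles (walk s) :=
  face s ((bridge n m).src (Sum.inr (Sum.inl e)))

/-- The component through the second half of an edge of the path. -/
noncomputable def pathD (e : Fin (n + 1)) : Cycles (walk s) :=
  face s ((bridge n m).tgt (Sum.inr (Sum.inl e)))

theorem pathC_zero : pathC s 0 = sideS s (Fin.last (n + 1)) := by
  rw [sideS, ← side_junction m]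
  rfl

theorem pathD_zero : pathD s 0 = sideT s (Fin.last (n + 1)) := by
  rw [sideT, ← side_junction m]
  exact (face_tgt s (Sum.inr (Sum.inl 0))).trans
    (congrArg (face s) (turn_inl s (Sum.inl (junction m (Fin.last (n + 1)))) _))

theorem tgt_last : (bridge n m).tgt (Sum.inr (Sum.inl (Fin.last n))) =
    Sum.inl (Sum.inl (junction m (Fin.last n).castSucc),
      side m (junction m (Fin.last n).castSucc)) := by
  simp [bridge]

theorem tgt_castSucc (i : Fin n) : (bridge n m).tgt (Sum.inr (Sum.inl i.castSucc)) =
    Sum.inl (Sum.inr i, 1) := by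
  simp [bridge]

theorem pathD_last : pathD s (Fin.last n) = sideS s (Fin.last n).castSucc := by
  rw [sideS, ← side_junction m, pathD, tgt_last]
  rfl

theorem pathC_last : pathC s (Fin.last n) = sideT s (Fin.last n).castSucc := by
  rw [sideT, ← side_junction m]
  refine (face_src s (Sum.inr (Sum.inl (Fin.last n)))).trans ?_
  rw [tgt_last]
  exact congrArg (face s) (turn_inl s (Sum.inl (junction m (Fin.last n).castSucc)) _)

theorem pathC_succ (i : Fin n) : pathC s i.succ = lab s (Sum.inr i) 0 := rfl

theorem pathD_succ (i : Fin n) : pathD s i.succ = lab s (Sum.inr i) (rot (s (Sum.inr i)) 0) :=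
  (face_tgt s (Sum.inr (Sum.inl i.succ))).trans (congrArg (face s) (turn_inl s (Sum.inr i) 0))

theorem pathD_castSucc (i : Fin n) : pathD s i.castSucc = lab s (Sum.inr i) 1 := by
  rw [pathD, tgt_castSucc]
  rfl

theorem pathC_castSucc (i : Fin n) :
    pathC s i.castSucc = lab s (Sum.inr i) (rot (s (Sum.inr i)) 1) := by
  refine (face_src s (Sum.inr (Sum.inl i.castSucc))).trans ?_
  rw [tgt_castSucc]
  exact congrArg (face s) (turn_inl s (Sum.inr i) 1)

theorem sideS_rung (i : Fin n) :
    sideS s i.castSucc.castSucc = lab s (Sum.inr i) (rot (s (Sum.inr i)) 2) := by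
  rw [sideS, ← side_junction m]
  exact (face_tgt s (Sum.inr (Sum.inr (Sum.inl i)))).trans
    (congrArg (face s) (turn_inl s (Sum.inr i) 2))

theorem sideT_rung (i : Fin n) : sideT s i.castSucc.castSucc = lab s (Sum.inr i) 2 := by
  rw [sideT, ← side_junction m]
  exact ((face_src s (Sum.inr (Sum.inr (Sum.inl i)))).trans
    (congrArg (face s) (turn_inl s (Sum.inl (junction m i.castSucc.castSucc)) _))).symm

theorem path_pos {i : Fin n} (h : s (Sum.inr i) = true) :
    pathD s i.castSucc = pathD s i.succ ∧ sideT s i.castSucc.castSucc = pathC s i.castSucc ∧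
      sideS s i.castSucc.castSucc = pathC s i.succ := by
  rw [pathD_castSucc, pathD_succ, sideT_rung, pathC_castSucc, sideS_rung, pathC_succ, h]
  exact ⟨rfl, rfl, rfl⟩

theorem path_neg {i : Fin n} (h : s (Sum.inr i) = false) :
    pathC s i.castSucc = pathC s i.succ ∧ sideS s i.castSucc.castSucc = pathD s i.castSucc ∧
      sideT s i.castSucc.castSucc = pathD s i.succ := by
  rw [pathD_castSucc, pathD_succ, sideT_rung, pathC_castSucc, sideS_rung, pathC_succ, h]
  exact ⟨rfl, rfl, rfl⟩

theorem add_one_last : (Fin.last (n + 1) + 1 : Fin (n + 2)) = 0 := Fin.last_add_one _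

/-- Every component runs along the outer cycle or along the path. -/
theorem face_cases (h : (bridge n m).HalfEdge) :
    (∃ i, face s h = outerSide s i ∨ face s h = innerSide s i) ∨
      ∃ e, face s h = pathC s e ∨ face s h = pathD s e := by
  have hS : ∀ i, sideS s i = outerSide s i ∨ sideS s i = innerSide s (i + 1) := fun i => by
    cases hi : s (Sum.inl (junction m i))
    · exact Or.inl (junction_neg s hi).2.1
    · exact Or.inr (junction_pos s hi).2.2
  have hleg : ∀ (i : Fin (n + 2)) (j : Fin (m i)),
      lab s (Sum.inl ⟨i, j.castSucc⟩) 2 = outerSide s i ∨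
        lab s (Sum.inl ⟨i, j.castSucc⟩) 2 = innerSide s i := by
    intro i j
    have h1 := lab_back s i j.castSucc
    have h2 := lab_leg_turn s ⟨i, j⟩
    rw [back_castSucc] at h1
    cases hi : s (Sum.inl ⟨i, j.castSucc⟩) <;> simp only [hi] at h1 h2
    · exact Or.inr (h2.trans h1.1)
    · exact Or.inl h1.2
  rcases h with ⟨⟨i, j⟩ | i, x⟩ | l
  · left
    induction j using Fin.lastCases with
    | last =>
      fin_cases x
      · exact ⟨i + 1, Or.inl (outerSide_add_one s i).symm⟩
      · rcases hS i with h | h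
        · exact ⟨i, Or.inl h⟩
        · exact ⟨i + 1, Or.inr h⟩
      · exact ⟨i, Or.inr rfl⟩
    | cast j =>
      have h1 := lab_back s i j.castSucc
      rw [back_castSucc] at h1
      fin_cases x
      · have h2 := lab_zero s ⟨i, j.castSucc⟩
        rw [next_castSucc, (lab_back s i j.succ).2] at h2
        exact ⟨i, Or.inl h2⟩
      · exact ⟨i, Or.inr h1.1⟩
      · exact ⟨i, hleg i j⟩
  · fin_cases x
    · exact Or.inr ⟨i.succ, Or.inl rfl⟩
    · exact Or.inr ⟨i.castSucc, Or.inr (pathD_castSucc s i).symm⟩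
    · left
      have h1 : face s (Sum.inl (Sum.inr i, 2)) = sideT s i.castSucc.castSucc :=
        (sideT_rung s i).symm
      cases hi : s (Sum.inl (junction m i.castSucc.castSucc))
      · exact ⟨_, Or.inl (h1.trans (junction_neg s hi).2.2)⟩
      · exact ⟨_, Or.inr (h1.trans (junction_pos s hi).2.1)⟩
  · left
    obtain ⟨i, j⟩ := l
    have := hleg i j
    rw [lab_leg s ⟨i, j⟩] at this
    exact ⟨i, this⟩

/-- The boundary components of a state of a bridge. -/
noncomputable def strip : Strip (Cycles (walk s)) n
    (fun i => s (Sum.inl (junction m i.castSucc.castSucc))) (fun i => s (Sum.inr i))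
    (s (Sum.inl (junction m (Fin.last (n + 1)))))
    (s (Sum.inl (junction m (Fin.last n).castSucc))) where
  A i := outerSide s i.castSucc
  B i := innerSide s i.castSucc
  C := pathC s
  D := pathD s
  S i := sideS s i.castSucc.castSucc
  T i := sideT s i.castSucc.castSucc
  A' := outerSide s (Fin.last (n + 1))
  B' := innerSide s (Fin.last (n + 1))
  r_pos i h := by
    have := junction_pos s h
    rwa [castSucc_add_one, Fin.succ_castSucc] at this
  r_neg i h := by
    have := junction_neg s h
    rwa [castSucc_add_one, Fin.succ_castSucc] at this
  t_pos i h := path_pos s h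
  t_neg i h := path_neg s h
  p_pos h := by
    have := junction_pos s h
    rw [add_one_last, ← pathC_zero, ← pathD_zero] at this
    exact ⟨this.1.symm, this.2.2.symm, this.2.1⟩
  p_neg h := by
    have := junction_neg s h
    rw [add_one_last, ← pathC_zero, ← pathD_zero] at this
    exact ⟨this.1.symm, this.2.2.symm, this.2.1⟩
  q_pos h := by
    have := junction_pos s h
    rw [castSucc_add_one, Fin.succ_last, ← pathC_last, ← pathD_last] at this
    exact ⟨this.1, this.2.1.symm, this.2.2⟩
  q_neg h := by
    have := junction_neg s h
    rw [castSucc_add_one, Fin.succ_last, ← pathC_last, ← pathD_last] at this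
    exact ⟨this.1, this.2.1.symm, this.2.2⟩
  cover x := by
    obtain ⟨h, rfl⟩ := cyc_surjective _ x
    have hlast : (∃ i, outerSide s (Fin.last (n + 1)) = outerSide s (Fin.castSucc i) ∨
          outerSide s (Fin.last (n + 1)) = pathC s i) ∧
        (∃ i, innerSide s (Fin.last (n + 1)) = innerSide s (Fin.castSucc i) ∨
          innerSide s (Fin.last (n + 1)) = pathD s i) := by
      cases hp : s (Sum.inl (junction m (Fin.last (n + 1))))
      · have := junction_neg s hp
        rw [add_one_last, ← pathC_zero, ← pathD_zero] at this
        exact ⟨⟨0, Or.inr this.2.1.symm⟩, ⟨0, Or.inl this.1⟩⟩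
      · have := junction_pos s hp
        rw [add_one_last, ← pathC_zero, ← pathD_zero] at this
        exact ⟨⟨0, Or.inl this.1⟩, ⟨0, Or.inr this.2.1.symm⟩⟩
    rcases face_cases s h with ⟨i, h1⟩ | ⟨e, h1⟩
    · induction i using Fin.lastCases with
      | cast i =>
        rcases h1 with h1 | h1
        · exact ⟨i, Or.inl h1⟩
        · exact ⟨i, Or.inr (Or.inl h1)⟩
      | last =>
        obtain ⟨⟨i, hi⟩, ⟨j, hj⟩⟩ := hlast
        rcases h1 with h1 | h1
        · rcases hi with hi | hi
          · exact ⟨i, Or.inl (h1.trans hi)⟩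
          · exact ⟨i, Or.inr (Or.inr (Or.inl (h1.trans hi)))⟩
        · rcases hj with hj | hj
          · exact ⟨j, Or.inr (Or.inl (h1.trans hj))⟩
          · exact ⟨j, Or.inr (Or.inr (Or.inr (h1.trans hj)))⟩
    · rcases h1 with h1 | h1
      · exact ⟨e, Or.inr (Or.inr (Or.inl h1))⟩
      · exact ⟨e, Or.inr (Or.inr (Or.inr h1))⟩

end Labels

end PontNeuf

/-! ### Planar states of a bridge -/

namespace Diagram

variable {Γ : Diagram}

/-- Reversing all signs exchanges the two sides of each edge. -/
theorem apply_opp_opp {F : Type*} {s s' : Γ.V → Bool} (hs : ∀ v, s' v = !s v)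
    {f : Γ.HalfEdge → F} (hf : ∀ h, f (Γ.opp h) = f (turn s h)) (h : Γ.HalfEdge) :
    f (Γ.opp (Γ.opp h)) = f (Γ.opp (turn s' h)) := by
  rw [opp_opp, hf]
  rcases h with ⟨v, k⟩ | l
  · rw [turn_inl, turn_inl, hs]
    cases s v <;> simp
  · rw [turn_inr, turn_inr]

end Diagram

namespace PontNeuf

variable {n : ℕ} {m : Fin (n + 2) → ℕ}

/-- A vertex of the outer cycle or of the path, as a vertex of the bridge. -/
def vtx (v : Outer m ⊕ Fin n) : (bridge n m).V := v

/-- A half-edge at a vertex of the outer cycle or of the path. -/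
def half (v : Outer m ⊕ Fin n) (k : Fin 3) : (bridge n m).HalfEdge := Sum.inl (vtx v, k)

/-- The state with the sign `ε` at all vertices that carry no leg and the sign `t l` at the vertex
of the leg `l`. -/
def extend (ε : Bool) (t : (i : Fin (n + 2)) × Fin (m i) → Bool) :
    (bridge n m).V → Bool :=
  Sum.elim (fun c => Fin.lastCases (motive := fun _ => Bool) ε (fun j => t ⟨c.1, j⟩) c.2)
    (fun _ => ε)

theorem extend_junction (ε : Bool) (t : (i : Fin (n + 2)) × Fin (m i) → Bool) (i : Fin (n + 2)) :
    extend ε t (vtx (Sum.inl (junction m i))) = ε := by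
  simp [extend, junction, vtx]

theorem extend_leg (ε : Bool) (t : (i : Fin (n + 2)) × Fin (m i) → Bool)
    (l : (i : Fin (n + 2)) × Fin (m i)) :
    extend ε t (vtx (Sum.inl ⟨l.1, l.2.castSucc⟩)) = t l := by
  simp [extend, vtx]

/-- For the planar embedding: the face at the corner following the given half-edge, where a leg
lies in the outer face or in the face of its block according to `t`. -/
def corner (t : (i : Fin (n + 2)) × Fin (m i) → Bool) :
    (bridge n m).HalfEdge → Option (Fin (n + 2)) :=
  Sum.elim
    (fun x => Sum.elim
      (fun c : Outer m => Fin.lastCases (motive := fun _ => Option (Fin (n + 2)))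
        (![none, some (c.1 + 1), some c.1] x.2)
        (fun j => ![none, some c.1, if t ⟨c.1, j⟩ then none else some c.1] x.2) c.2)
      (fun i : Fin n => ![some i.succ.castSucc, some (Fin.last (n + 1)),
        some i.castSucc.castSucc] x.2) x.1)
    (fun l => if t l then none else some l.1)

variable (t : (i : Fin (n + 2)) × Fin (m i) → Bool)

theorem corner_junction (i : Fin (n + 2)) (k : Fin 3) :
    corner t (half (Sum.inl (junction m i)) k) = ![none, some (i + 1), some i] k := by
  simp [corner, junction, half, vtx]

theorem corner_castSucc (l : (i : Fin (n + 2)) × Fin (m i)) (k : Fin 3) :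
    corner t (half (Sum.inl ⟨l.1, l.2.castSucc⟩) k) =
      ![none, some l.1, if t l then none else some l.1] k := by
  simp [corner, half, vtx]

theorem turn_half (v : Outer m ⊕ Fin n) (k : Fin 3) : turn (extend true t) (half v k) =
    half v (rot (extend true t (vtx v)) k) :=
  turn_inl (extend true t) v k

theorem turn_extend_junction (i : Fin (n + 2)) (k : Fin 3) :
    turn (extend true t) (half (Sum.inl (junction m i)) k) =
      half (Sum.inl (junction m i)) (k + 1) := by
  rw [turn_half, extend_junction]
  rfl

theorem turn_extend_path (i : Fin n) (k : Fin 3) :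
    turn (extend true t) (half (Sum.inr i) k) = half (Sum.inr i) (k + 1) :=
  turn_half t (Sum.inr i) k

theorem outer_cases {p : Outer m → Prop} (h1 : ∀ i, p (junction m i))
    (h2 : ∀ l : (i : Fin (n + 2)) × Fin (m i), p ⟨l.1, l.2.castSucc⟩) (c : Outer m) : p c := by
  obtain ⟨i, j⟩ := c
  induction j using Fin.lastCases with
  | last => exact h1 i
  | cast j => exact h2 ⟨i, j⟩

theorem corner_back (c : Outer m) : corner t (half (Sum.inl c) (back m c)) = some c.1 := by
  refine outer_cases (p := fun c => corner t (half (Sum.inl c) (back m c)) = some c.1)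
    (fun i => ?_) (fun l => ?_) c
  · rw [back_junction, corner_junction]
    rfl
  · rw [back_castSucc, corner_castSucc]
    rfl

theorem corner_turn_back (c : Outer m) :
    corner t (turn (extend true t) (half (Sum.inl c) (back m c))) = none := by
  refine outer_cases (p := fun c => corner t (turn (extend true t)
    (half (Sum.inl c) (back m c))) = none) (fun i => ?_) (fun l => ?_) c
  · rw [back_junction, turn_extend_junction, corner_junction]
    rfl
  · rw [back_castSucc, turn_half, corner_castSucc, extend_leg]
    cases h : t l <;> simp [rot]

theorem corner_zero (c : Outer m) : corner t (half (Sum.inl c) 0) = none := by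
  refine outer_cases (p := fun c => corner t (half (Sum.inl c) 0) = none)
    (fun i => ?_) (fun l => ?_) c
  · rw [corner_junction]
    rfl
  · rw [corner_castSucc]
    rfl

theorem corner_turn_zero (c : Outer m) :
    corner t (turn (extend true t) (half (Sum.inl c) 0)) = some (next m c).1 := by
  refine outer_cases (p := fun c => corner t (turn (extend true t)
    (half (Sum.inl c) 0)) = some (next m c).1) (fun i => ?_) (fun l => ?_) c
  · rw [turn_extend_junction, corner_junction, next_junction]
    rfl
  · rw [turn_half, corner_castSucc, extend_leg, next_castSucc]
    cases h : t l
    · have : rot false 0 = 2 := rfl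
      simp [this]
    · rfl

theorem corner_leg (l : (i : Fin (n + 2)) × Fin (m i)) :
    corner t (half (Sum.inl ⟨l.1, l.2.castSucc⟩) 2) = if t l then none else some l.1 := by
  rw [corner_castSucc]
  rfl

theorem corner_turn_leg (l : (i : Fin (n + 2)) × Fin (m i)) :
    corner t (turn (extend true t) (half (Sum.inl ⟨l.1, l.2.castSucc⟩) 2)) =
      if t l then none else some l.1 := by
  rw [turn_half, corner_castSucc, extend_leg]
  cases h : t l <;> rfl

theorem src_path_zero : (bridge n m).src (Sum.inr (Sum.inl 0)) =
    half (Sum.inl (junction m (Fin.last (n + 1)))) 1 :=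
  congrArg (half (Sum.inl (junction m (Fin.last (n + 1))))) (side_junction m _)

theorem tgt_path_last : (bridge n m).tgt (Sum.inr (Sum.inl (Fin.last n))) =
    half (Sum.inl (junction m (Fin.last n).castSucc)) 1 :=
  tgt_last.trans
    (congrArg (half (Sum.inl (junction m (Fin.last n).castSucc))) (side_junction m _))

theorem tgt_path_castSucc (i : Fin n) : (bridge n m).tgt (Sum.inr (Sum.inl i.castSucc)) =
    half (Sum.inr i) 1 := tgt_castSucc i

theorem corner_src_path (e : Fin (n + 1)) :
    corner t ((bridge n m).src (Sum.inr (Sum.inl e))) = some e.castSucc := by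
  induction e using Fin.cases with
  | zero =>
    refine (congrArg (corner t) src_path_zero).trans ?_
    rw [corner_junction, add_one_last]
    rfl
  | succ i => rfl

theorem corner_turn_src_path (e : Fin (n + 1)) :
    corner t (turn (extend true t) ((bridge n m).src (Sum.inr (Sum.inl e)))) =
      some (Fin.last (n + 1)) := by
  induction e using Fin.cases with
  | zero =>
    refine (congrArg (fun h => corner t (turn (extend true t) h)) src_path_zero).trans ?_
    rw [turn_extend_junction, corner_junction]
    rfl
  | succ i => exact congrArg (corner t) (turn_extend_path t i 0)

theorem corner_tgt_path (e : Fin (n + 1)) :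
    corner t ((bridge n m).tgt (Sum.inr (Sum.inl e))) = some (Fin.last (n + 1)) := by
  induction e using Fin.lastCases with
  | last =>
    refine (congrArg (corner t) tgt_path_last).trans ?_
    rw [corner_junction, castSucc_add_one, Fin.succ_last]
    rfl
  | cast i => exact congrArg (corner t) (tgt_path_castSucc i)

theorem corner_turn_tgt_path (e : Fin (n + 1)) :
    corner t (turn (extend true t) ((bridge n m).tgt (Sum.inr (Sum.inl e)))) =
      some e.castSucc := by
  induction e using Fin.lastCases with
  | last =>
    refine (congrArg (fun h => corner t (turn (extend true t) h)) tgt_path_last).trans ?_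
    rw [turn_extend_junction, corner_junction]
    rfl
  | cast i =>
    refine (congrArg (fun h => corner t (turn (extend true t) h)) (tgt_path_castSucc i)).trans ?_
    exact congrArg (corner t) (turn_extend_path t i 1)

/-- The corners along a boundary walk belong to the same face. -/
theorem corner_opp (h : (bridge n m).HalfEdge) :
    corner t ((bridge n m).opp h) = corner t (turn (extend true t) h) := by
  refine apply_opp_of_edges ?_ ?_ h
  · rintro (c | e | i | l)
    · exact (corner_back t (next m c)).trans (corner_turn_zero t c).symm
    · exact (corner_tgt_path t e).trans (corner_turn_src_path t e).symm
    · refine (congrArg (fun k => corner t (half (Sum.inl (junction m i.castSucc.castSucc)) k))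
        (side_junction m _)).trans ?_
      rw [corner_junction, castSucc_add_one, Fin.succ_castSucc]
      exact (congrArg (corner t) (turn_extend_path t i 2)).symm
    · refine (congrArg (fun k => corner t (half (Sum.inl ⟨l.1, l.2.castSucc⟩) k))
        (side_castSucc m _ _)).trans ?_
      exact corner_leg t l
  · rintro (c | e | i | l)
    · exact (corner_zero t c).trans (corner_turn_back t (next m c)).symm
    · exact (corner_src_path t e).trans (corner_turn_tgt_path t e).symm
    · refine Eq.trans ?_ (congrArg (fun k => corner t (turn (extend true t)
        (half (Sum.inl (junction m i.castSucc.castSucc)) k))) (side_junction m _)).symm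
      exact ((congrArg (corner t) (turn_extend_junction t i.castSucc.castSucc 1)).trans
        (corner_junction t i.castSucc.castSucc 2)).symm
    · refine Eq.trans ?_ (congrArg (fun k => corner t (turn (extend true t)
        (half (Sum.inl ⟨l.1, l.2.castSucc⟩) k))) (side_castSucc m _ _)).symm
      exact (corner_turn_leg t l).symm

theorem corner_surjective : Function.Surjective (corner t) := by
  rintro (_ | i)
  · exact ⟨_, corner_zero t (junction m 0)⟩
  · exact ⟨_, corner_back t (junction m i)⟩

theorem card_cycles_bridge_le (s : (bridge n m).V → Bool) :
    Fintype.card (Cycles (walk s)) ≤ n + 3 := (strip s).card_le.1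

theorem extend_not (t : (i : Fin (n + 2)) × Fin (m i) → Bool) (v : (bridge n m).V) :
    extend false t v = !extend true (fun l => !t l) v := by
  rcases v with c | i
  · refine outer_cases (p := fun c => extend false t (vtx (Sum.inl c)) =
      !extend true (fun l => !t l) (vtx (Sum.inl c))) (fun i => ?_) (fun l => ?_) c
    · rw [extend_junction, extend_junction]
      rfl
    · rw [extend_leg, extend_leg, Bool.not_not]
  · rfl

/-- The block of a leg. -/
def block (l : (i : Fin (n + 2)) × Fin (m i)) : Fin (n + 2) := l.1

theorem stateMonomial_extend_true :
    stateMonomial (extend true t) = monomial (Arch.faceExp block t) 1 ∧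
      Fintype.card (Cycles (walk (extend true t))) = n + 3 :=
  stateMonomial_eq (corner_opp t) (corner_surjective t) (card_cycles_bridge_le _) fun _ => rfl

theorem stateMonomial_extend_false :
    stateMonomial (extend false t) = monomial (Arch.faceExp block fun l => !t l) 1 ∧
      Fintype.card (Cycles (walk (extend false t))) = n + 3 :=
  stateMonomial_eq (f := fun h => corner (fun l => !t l) ((bridge n m).opp h))
    (apply_opp_opp (extend_not t) (corner_opp _))
    ((corner_surjective _).comp (bridge n m).opp.surjective) (card_cycles_bridge_le _) fun l => by
    rw [corner_opp, turn_inr]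
    rfl

theorem stateSign_extend (ε : Bool) : stateSign (extend ε t) = ∏ l, boolSign (t l) := by
  have h1 : ∀ i : Fin (n + 2), ∏ j : Fin (m i + 1), boolSign (extend ε t (vtx (Sum.inl ⟨i, j⟩))) =
      (∏ j : Fin (m i), boolSign (t ⟨i, j⟩)) * boolSign ε := by
    intro i
    rw [Fin.prod_univ_castSucc]
    congr 1
    · exact Finset.prod_congr rfl fun j _ => by rw [extend_leg ε t ⟨i, j⟩]
    · exact congrArg boolSign (extend_junction ε t i)
  have h2 : stateSign (extend ε t) = (∏ c : Outer m, boolSign (extend ε t (vtx (Sum.inl c)))) *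
      ∏ _i : Fin n, boolSign ε := Fintype.prod_sum_type _
  rw [h2, Fintype.prod_sigma, Finset.prod_congr rfl fun i _ => h1 i, Finset.prod_mul_distrib,
    Fintype.prod_sigma, Finset.prod_const, Finset.prod_const, Finset.card_univ, Finset.card_univ,
    Fintype.card_fin, Fintype.card_fin, mul_assoc, ← pow_add]
  -- the number of vertices without leg is even
  have h3 : n + 2 + n = 2 * (n + 1) := by ring
  rw [h3, pow_mul, sq, boolSign_mul_self, one_pow, mul_one]

/-- A state with the maximal number of boundary components has the same sign at all vertices
without leg. -/
theorem eq_extend {s : (bridge n m).V → Bool} (h : Fintype.card (Cycles (walk s)) = n + 3) :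
    extend (s (vtx (Sum.inl (junction m (Fin.last (n + 1))))))
      (fun l => s (vtx (Sum.inl ⟨l.1, l.2.castSucc⟩))) = s := by
  obtain ⟨h1, h2⟩ := (strip s).card_le.2 h
  funext v
  rcases v with c | i
  · refine outer_cases (p := fun c => extend _ _ (vtx (Sum.inl c)) = s (vtx (Sum.inl c)))
      (fun i => ?_) (fun l => ?_) c
    · rw [extend_junction]
      induction i using Fin.lastCases with
      | last => rfl
      | cast i =>
        induction i using Fin.lastCases with
        | last => exact h2.symm
        | cast i => exact (h1 i).1.symm
    · rw [extend_leg]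
  · exact (h1 i).2.symm

/-- The states with the maximal number of boundary components are the two plane embeddings with
all distributions of the legs; both embeddings contribute the same. -/
theorem homogeneousComponent_bridge (hm : Even (bridge n m).legs) :
    homogeneousComponent (n + 3) (statePoly (bridge n m)) =
      (2 : ℂ) • Arch.archPoly (block (m := m)) := by
  have h1 : ∀ g : ((bridge n m).V → Bool) → MvPolynomial ℕ ℂ,
      ∑ s : (bridge n m).V → Bool with Fintype.card (Cycles (walk s)) = n + 3, g s =
      ∑ x : Bool × ((i : Fin (n + 2)) × Fin (m i) → Bool), g (extend x.1 x.2) := by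
    intro g
    refine Finset.sum_nbij' (fun s => (s (vtx (Sum.inl (junction m (Fin.last (n + 1))))),
      fun l => s (vtx (Sum.inl ⟨l.1, l.2.castSucc⟩)))) (fun x => extend x.1 x.2) (by simp)
      ?_ ?_ ?_ ?_
    · rintro ⟨ε, t⟩ _
      rw [Finset.mem_filter]
      refine ⟨Finset.mem_univ _, ?_⟩
      cases ε
      · exact (stateMonomial_extend_false t).2
      · exact (stateMonomial_extend_true t).2
    · intro s hs
      exact eq_extend (Finset.mem_filter.1 hs).2
    · rintro ⟨ε, t⟩ _
      exact Prod.ext (extend_junction ε t _) (funext fun l => extend_leg ε t l)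
    · intro s hs
      exact congrArg g (eq_extend (Finset.mem_filter.1 hs).2).symm
  rw [homogeneousComponent_statePoly rfl, h1, Fintype.sum_prod_type, Fintype.sum_bool, two_smul]
  congr 1
  · refine Finset.sum_congr rfl fun t _ => ?_
    rw [stateSign_extend, (stateMonomial_extend_true t).1]
  · let e : ((i : Fin (n + 2)) × Fin (m i) → Bool) ≃ ((i : Fin (n + 2)) × Fin (m i) → Bool) :=
      (Equiv.refl _).arrowCongr Equiv.boolNot
    rw [Arch.archPoly, ← e.sum_comp]
    refine Finset.sum_congr rfl fun t _ => ?_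
    have he : e t = fun l => !t l := rfl
    have hee : (fun l => !e t l) = t := by simp [he]
    change stateSign (extend false (e t)) • stateMonomial (extend false (e t)) = _
    rw [stateSign_extend, (stateMonomial_extend_false (e t)).1, hee, he]
    simp only [boolSign_not]
    rw [Finset.prod_neg, Finset.card_univ]
    have : Even (Fintype.card ((i : Fin (n + 2)) × Fin (m i))) := hm
    rw [this.neg_one_pow, one_mul]

theorem hasSizes_block (a : Fin (n + 1) → ℕ) (b : ℕ) :
    Arch.HasSizes (block (m := Fin.snoc (α := fun _ => ℕ) a (2 * b))) a b := by
  have h : ∀ i : Fin (n + 2), (Finset.univ.filter fun l : (i : Fin (n + 2)) ×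
      Fin (Fin.snoc (α := fun _ => ℕ) a (2 * b) i : ℕ) => block l = i).card =
      Fin.snoc (α := fun _ => ℕ) a (2 * b) i := by
    intro i
    rw [← Fintype.card_subtype, ← Fintype.card_fin (Fin.snoc (α := fun _ => ℕ) a (2 * b) i)]
    exact Fintype.card_congr (Equiv.sigmaSubtype i)
  exact ⟨fun i => by rw [h, Fin.snoc_castSucc], by rw [h, Fin.snoc_last]⟩

theorem CD_bridge {a : Fin (n + 1) → ℕ} {b : ℕ} (hb : ∀ i, a i ≤ b)
    (heven : Even (∑ i, a i + 2 * b)) :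
    (bridge n (Fin.snoc (α := fun _ => ℕ) a (2 * b))).CD =
      (2 : ℂ) • Arch.archPoly (block (m := Fin.snoc (α := fun _ => ℕ) a (2 * b))) := by
  have hlegs : (bridge n (Fin.snoc (α := fun _ => ℕ) a (2 * b))).legs = ∑ i, a i + 2 * b := by
    have : (bridge n (Fin.snoc (α := fun _ => ℕ) a (2 * b))).legs = Fintype.card
        ((i : Fin (n + 2)) × Fin (Fin.snoc (α := fun _ => ℕ) a (2 * b) i : ℕ)) := rfl
    rw [this, Fintype.card_sigma, Fin.sum_univ_castSucc]
    simp
  have h1 := homogeneousComponent_bridge (n := n) (m := Fin.snoc (α := fun _ => ℕ) a (2 * b))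
    (by rw [hlegs]; exact heven)
  rw [CD_eq rfl card_cycles_bridge_le ?_, h1]
  rw [h1]
  refine smul_ne_zero two_ne_zero fun h => ?_
  exact (hasSizes_block a b).coeff_ne_zero hb (by rw [h, coeff_zero])

end PontNeuf

/-- Up to a factor, the leading polynomial of a Pont Neuf diagram is the signed sum over the
distributions of its legs to the faces of the plane embedding. -/
theorem CD_pontNeuf {k : ℕ} {a : Fin k → ℕ} {b : ℕ} (hb : ∀ i, a i ≤ b)
    (heven : Even (∑ i, a i + 2 * b)) :
    ∃ (c : ℂ) (L : Type) (_ : Fintype L) (_ : DecidableEq L) (β : L → Fin (k + 1)),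
      c ≠ 0 ∧ Arch.HasSizes β a b ∧ (pontNeuf k a b).CD = c • Arch.archPoly β := by
  cases k with
  | zero => exact ⟨1, _, _, _, _, one_ne_zero, hasSizes_wheel b a,
      (CD_wheel b).trans (one_smul ℂ _).symm⟩
  | succ n => exact ⟨2, _, _, _, _, two_ne_zero, PontNeuf.hasSizes_block a b,
      PontNeuf.CD_bridge hb heven⟩

theorem mainTheorem3 (k u : ℕ) (hu : Even u) :
    (∀ p ∈ pontNeufIndex k u, ∃! P : MvPolynomial ℕ ℂ,
      (pontNeuf k p.1 p.2).IsHighestWeightPart P) ∧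
    LinearIndependent ℂ
      (fun p : pontNeufIndex k u => (pontNeuf k p.1.1 p.1.2).CD) := by
  refine ⟨fun p _ => existsUnique_isHighestWeightPart,
    Arch.linearIndependent_of_coeff _ (fun p q hne => ?_) (fun p => ?_)⟩
  all_goals
    obtain ⟨c, L, _, _, β, hc, hβ, hCD⟩ := CD_pontNeuf p.2.2.1 (by rw [p.2.2.2]; exact hu)
  · rw [hCD, coeff_smul, smul_eq_mul] at hne
    exact hβ.le_of_coeff_ne_zero p.2.1 q.2.1 q.2.2.1 (right_ne_zero_of_mul hne)
  · rw [hCD, coeff_smul, smul_eq_mul]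
    exact mul_ne_zero hc (hβ.coeff_ne_zero p.2.2.1)
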